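/- Let $p>0$, $L>0$, $n\in\mathbb N=\{1,2,\dots\}$ and $\omega_n:=\pi^2n^2/L^2$. For $\omega<\omega_n$ let $u^{\pm}_{n,\omega}$ denote the two odd solutions on $\mathbb R$ of $-u''-(p+1)|u|^{2p}u=\omega u$ with minimal period $2L/n$ (so they are $2L$-periodic and vanish at $x=0,\pm L$), distinguished by the sign of $u'(0)$. Let $u=u^{\pm}_{n,\omega}$ and let $q$ be either $(p+1)|u|^{2p}$ (operator $L_-$) or $(2p+1)(p+1)|u|^{2p}$ (operator $L_+$). Consider the spectral problem on the tadpole graph, for $(U,V)\in H^2(-L,L)\times H^2(L,\infty)$, $(U,V)\neq 0$, $\lambda\in\mathbb C$: $$-U''-\omega U-qU=\lambda U\ \text{ on }(-L,L),\qquad -V''-\omega V=\lambda V\ \text{ on }(L,\infty),\tag{1}$$ $$U(L)=U(-L)=V(L),\qquad U'(L)-U'(-L)=V'(L),$$ and, for real $\lambda$ and nonzero $U\in H^2(-L,L)$, the ring problem $$-U''-\omega U-qU=\lambda U\ \text{ on }(-L,L),\qquad U(L)=U(-L),\qquad U'(L)-U'(-L)=-U(L)\sqrt{|\omega+\lambda|}.\tag{2}$$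 Call $U$ non-periodic if $U\notin H^2_{\rm per}(-L,L)$, i.e. if $U\in H^2(-L,L)$ does not satisfy both $U(L)=U(-L)$ and $U'(L)=U'(-L)$. The following holds for both choices of sign and both choices of $q$. (a) For every $\omega<\omega_n$, $(U,V)$ is an eigenfunction of (1) for the eigenvalue $\lambda\in\mathbb C$ with $V\not\equiv0$ if and only if $\lambda$ is real, $\lambda+\omega<0$ (that is, $\lambda$ lies below the continuous spectrum $[-\omega,\infty)$), $U$ is a non-periodic eigenfunction of (2) for $\lambda$, and $V(x)=U(L)e^{-\sqrt{|\omega+\lambda|}(x-L)}$ for $x\ge L$. Moreover, for $\lambda+\omega<0$ every non-periodic eigenfunction $U$ of (2) is even. (b) There is $\varepsilon_0>0$, depending only on $p$, $L$, $n$, such that for $\omega=-\varepsilon^2$ with $0<\varepsilon<\varepsilon_0$ there are exactly $n$ negative $\lambda$ for which (2) has a non-periodic eigenfunction; for each of these $\lambda$ the non-periodic eigenfunctions are all multiples of one another; and (2) has no non-periodic eigenfunction for $\lambda=0$. -/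

import Mathlib

open MeasureTheory

/-- `f` belongs to the Sobolev space `H²` of the interval `I`, with first derivative `f₁` (its
continuous representative) and second derivative `f₂`: the three functions are square integrable
on `I`, and `f`, `f₁` are primitives on `I` of `f₁`, `f₂`. As `f` and `f₁` are continuous on the
(closed) interval `I`, their values at the end points of `I` are the boundary traces.
The values of the functions outside `I` play no role. -/
structure IsH2On (I : Set ℝ) (f f₁ f₂ : ℝ → ℂ) : Prop where
  memLp_zero : MemLp f 2 (volume.restrict I)
  memLp_one : MemLp f₁ 2 (volume.restrict I)
  memLp_two : MemLp f₂ 2 (volume.restrict I)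
  primitive_zero : ∀ x ∈ I, ∀ y ∈ I, f y - f x = ∫ t in x..y, f₁ t
  primitive_one : ∀ x ∈ I, ∀ y ∈ I, f₁ y - f₁ x = ∫ t in x..y, f₂ t

/-- `U ∈ H²_per(-L, L)`: `U ∈ H²(-L, L)` with `U(L) = U(-L)` and `U'(L) = U'(-L)`. -/
def MemH2Per (L : ℝ) (U : ℝ → ℂ) : Prop :=
  ∃ U₁ U₂ : ℝ → ℂ, IsH2On (Set.Icc (-L) L) U U₁ U₂ ∧ U L = U (-L) ∧ U₁ L = U₁ (-L)

/-- The domain of the Laplacian on the tadpole graph: `(U, V) ∈ H²(-L, L) × H²(L, ∞)`, with the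
derivatives `U₁, U₂` of `U` and `V₁, V₂` of `V`, subject to the Kirchhoff boundary conditions
`U(L) = U(-L) = V(L)` and `U'(L) - U'(-L) = V'(L)`. -/
structure IsTadpoleDomain (L : ℝ) (U U₁ U₂ V V₁ V₂ : ℝ → ℂ) : Prop where
  ring : IsH2On (Set.Icc (-L) L) U U₁ U₂
  tail : IsH2On (Set.Ici L) V V₁ V₂
  continuity_ring : U L = U (-L)
  continuity_tail : U L = V L
  kirchhoff : U₁ L - U₁ (-L) = V₁ L

/-- `(U, V)` is an eigenfunction, for the eigenvalue `lam`, of the spectral problem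
`-U'' - ω U - q U = lam U` on `(-L, L)`, `-V'' - ω V = lam V` on `(L, ∞)`
on the tadpole graph, with the Kirchhoff boundary conditions. -/
def IsTadpoleEigenfunction (L ω : ℝ) (q : ℝ → ℝ) (lam : ℂ) (U V : ℝ → ℂ) : Prop :=
  ((∃ x ∈ Set.Icc (-L) L, U x ≠ 0) ∨ (∃ x ∈ Set.Ici L, V x ≠ 0)) ∧
  ∃ U₁ U₂ V₁ V₂ : ℝ → ℂ, IsTadpoleDomain L U U₁ U₂ V V₁ V₂ ∧
    (∀ᵐ x ∂(volume.restrict (Set.Ioo (-L) L)), -U₂ x - ω * U x - q x * U x = lam * U x) ∧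
    (∀ᵐ x ∂(volume.restrict (Set.Ioi L)), -V₂ x - ω * V x = lam * V x)

/-- `U` is an eigenfunction, for the real eigenvalue `lam`, of the problem on the ring with the
energy-dependent boundary condition:
`-U'' - ω U - q U = lam U` on `(-L, L)`, `U(L) = U(-L)`,
`U'(L) - U'(-L) = -U(L) √|ω + lam|`. -/
def IsRingEigenfunction (L ω : ℝ) (q : ℝ → ℝ) (lam : ℝ) (U : ℝ → ℂ) : Prop :=
  (∃ x ∈ Set.Icc (-L) L, U x ≠ 0) ∧
  ∃ U₁ U₂ : ℝ → ℂ, IsH2On (Set.Icc (-L) L) U U₁ U₂ ∧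
    (∀ᵐ x ∂(volume.restrict (Set.Ioo (-L) L)), -U₂ x - ω * U x - q x * U x = lam * U x) ∧
    U L = U (-L) ∧
    U₁ L - U₁ (-L) = -(U L * (Real.sqrt |ω + lam| : ℝ))

/-- `u` is one of the two stationary states `u⁺_{n,ω}`, `u⁻_{n,ω}` on the ring: an odd solution of
`-u'' - (p+1)|u|^{2p} u = ω u` which is periodic with minimal period `2L/n`. In particular `u` is
`2L`-periodic and vanishes at `-L`, `0` and `L`; the sign of `u'(0)` distinguishes the two states. -/
structure IsRingState (p L : ℝ) (n : ℕ) (ω : ℝ) (u : ℝ → ℝ) : Prop where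
  contDiff : ContDiff ℝ 2 u
  equation : ∀ x, -deriv (deriv u) x - (p + 1) * |u x| ^ (2 * p) * u x = ω * u x
  odd : ∀ x, u (-x) = -u x
  period : IsLeast {τ : ℝ | 0 < τ ∧ Function.Periodic u τ} (2 * L / n)

/-- The potential of the operator `L₋` at the state `(u, 0)`. -/
noncomputable def potentialMinus (p : ℝ) (u : ℝ → ℝ) : ℝ → ℝ :=
  fun x => (p + 1) * |u x| ^ (2 * p)

/-- The potential of the operator `L₊` at the state `(u, 0)`. -/
noncomputable def potentialPlus (p : ℝ) (u : ℝ → ℝ) : ℝ → ℝ :=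
  fun x => (2 * p + 1) * (p + 1) * |u x| ^ (2 * p)

/-! Put Q = ω + λ + q with λ + ω < 0 and k = √|ω + λ|. The potential q is even and has period T =
L/n, because only |u| enters it. Let φ and ψ be the even and odd solutions of f'' = -Q f with
Wronskian one. Every solution on the ring is z₀φ + z₁ψ, and the boundary conditions decouple:
continuity gives z₁ψ(L) = 0, and then the jump gives z₀(2φ'(L) + kφ(L)) = 0. A non-periodic solution
needs z₀ ≠ 0, hence 2φ'(L) + kφ(L) = 0.

Evenness amounts to z₁ = 0, that is, to ψ(L) ≠ 0 at such λ. This follows from the gap inequality: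
ψ(nT) = 0 implies φ(nT)φ'(nT) ≥ 0, which is incompatible with 2φφ' = -kφ² < 0. Monodromy reduces the
inequality from n periods to one, and the symmetry about T/2 reduces it to half a period. There
`IsHalfWave.half_alternative` proves it with a monotone quantity built from φψ and Q/Q'; the profile
enters only through uu'' ≤ (1+p)u'², a consequence of energy conservation.

On the tadpole, a square integrable nonzero tail is a pure exponential with rate κ, Re κ > 0. The
flux Im(Ū U') around the ring forces κ to be real (`decay_rate_im_eq_zero`), so λ is real with λ + ω
= -κ² < 0.

For the count, let θ be the Prüfer angle of φ. The boundary condition reads cos Θ = 0 with Θ(λ) =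
θ(L) - arctan(k/2). As λ increases to 0, θ(L) increases and k decreases, so Θ is strictly
increasing. It stays above -π/2, is below π/2 for very negative λ, and at λ = 0 lies strictly
between nπ - π/2 and nπ + π/2. It therefore crosses exactly n zeros of the cosine. The location at λ
= 0 uses explicit solutions: u' is the even solution for L₊ and u the odd one for L₋, where the gap
inequality supplies the missing half of the estimate. -/

/-- The pair `(f, f')` solves `f'' = -Q f` on the real line, with `f'` the derivative of `f`. -/
structure IsLinearSolution (Q f f' : ℝ → ℝ) : Prop where
  hasDerivAt : ∀ x, HasDerivAt f (f' x) x
  hasDerivAt' : ∀ x, HasDerivAt f' (-(Q x * f x)) x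

/-- `θ` is a Prüfer angle for `f'' = -Q f`, i.e. `f = r sin θ`, `f' = r cos θ`. -/
def IsPruferAngle (Q θ : ℝ → ℝ) : Prop :=
  ∀ x, HasDerivAt θ (1 + (Q x - 1) * Real.sin (θ x) ^ 2) x

/-- The two solutions of `f'' = -Q f` with initial data `(1, 0)` and `(0, 1)` at the origin. -/
structure IsFundamental (Q φ φ' ψ ψ' : ℝ → ℝ) : Prop where
  left : IsLinearSolution Q φ φ'
  right : IsLinearSolution Q ψ ψ'
  left_zero : φ 0 = 1
  left_zero' : φ' 0 = 0
  right_zero : ψ 0 = 0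
  right_zero' : ψ' 0 = 1

/-! ### Prüfer angles: global existence, uniqueness, amplitude -/

theorem exists_global_solution_of_bounded {v : ℝ → ℝ → ℝ} {K M : NNReal}
    (hK : ∀ t, LipschitzWith K (v t)) (hc : ∀ x, Continuous (fun t => v t x))
    (hM : ∀ t x, ‖v t x‖ ≤ M) (x₀ : ℝ) :
    ∃ α : ℝ → ℝ, α 0 = x₀ ∧ ∀ t, HasDerivAt α (v t (α t)) t := by
  have loc : ∀ N : ℕ, ∃ α : ℝ → ℝ, α 0 = x₀ ∧
      ∀ t ∈ Set.Ioo (-((N : ℝ) + 1)) (N + 1), HasDerivAt α (v t (α t)) t := by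
    intro N
    have h0 : (0 : ℝ) ∈ Set.Icc (-((N : ℝ) + 1)) (N + 1) := by
      constructor <;> linarith [(Nat.cast_nonneg N : (0 : ℝ) ≤ N)]
    -- A curve of speed at most M moves at most M(N + 1) in time N + 1, so with this radius
    -- Picard–Lindelöf covers the whole time interval.
    have hpl : IsPicardLindelof v (⟨0, h0⟩ : Set.Icc (-((N : ℝ) + 1)) (N + 1)) x₀
        (M * (N + 1)) 0 M K :=
      { lipschitzOnWith := fun t _ => (hK t).lipschitzOnWith
        continuousOn := fun x _ => (hc x).continuousOn
        norm_le := fun t _ x _ => hM t x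
        mul_max_le := by simp }
    obtain ⟨α, h1, h2⟩ := hpl.exists_eq_forall_mem_Icc_hasDerivWithinAt₀
    exact ⟨α, h1, fun t ht => (h2 t (Set.Ioo_subset_Icc_self ht)).hasDerivAt
      (Icc_mem_nhds ht.1 ht.2)⟩
  choose α hα0 hα using loc
  have agree : ∀ N k : ℕ, N ≤ k → ∀ t ∈ Set.Ioo (-((N : ℝ) + 1)) (N + 1), α N t = α k t := by
    intro N k hNk t ht
    have hNk' : (N : ℝ) ≤ k := by exact_mod_cast hNk
    have h0 : (0 : ℝ) ∈ Set.Ioo (-((N : ℝ) + 1)) (N + 1) := by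
      constructor <;> linarith [(Nat.cast_nonneg N : (0 : ℝ) ≤ N)]
    refine ODE_solution_unique_of_mem_Ioo (v := v) (s := fun _ => Set.univ)
      (fun t _ => (hK t).lipschitzOnWith) h0
      (fun s hs => ⟨hα N s hs, trivial⟩) (fun s hs => ⟨hα k s ?_, trivial⟩)
      ((hα0 N).trans (hα0 k).symm) ht
    exact ⟨by linarith [hs.1], by linarith [hs.2]⟩
  -- The index depends on the point, so differentiability at t needs one fixed solution near t:
  -- index ⌊|t|⌋ + 2 dominates every index occurring within distance one.
  refine ⟨fun t => α ⌊|t|⌋₊ t, by simp [hα0], fun t => ?_⟩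
  have key : ∀ s, |s| < |t| + 1 → α ⌊|s|⌋₊ s = α (⌊|t|⌋₊ + 2) s := by
    intro s hs
    refine agree _ _ ?_ s ?_
    · have : ⌊|s|⌋₊ ≤ ⌊|t| + 1⌋₊ := Nat.floor_le_floor hs.le
      rw [Nat.floor_add_one (abs_nonneg t)] at this
      omega
    · exact abs_lt.mp (Nat.lt_floor_add_one |s|)
  have hnear : ∀ᶠ s in nhds t, |s| < |t| + 1 :=
    (continuous_abs.tendsto t).eventually (gt_mem_nhds (by linarith))
  have hmem : t ∈ Set.Ioo (-(((⌊|t|⌋₊ + 2 : ℕ) : ℝ) + 1)) (((⌊|t|⌋₊ + 2 : ℕ) : ℝ) + 1) := by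
    apply abs_lt.mp
    have := Nat.lt_floor_add_one |t|
    push_cast
    linarith
  have hd := hα (⌊|t|⌋₊ + 2) t hmem
  have hE : (fun s => α ⌊|s|⌋₊ s) =ᶠ[nhds t] α (⌊|t|⌋₊ + 2) := hnear.mono key
  rw [← key t (by linarith)] at hd
  exact hd.congr_of_eventuallyEq hE

theorem Real.abs_sin_sq_sub_sin_sq_le (a b : ℝ) :
    |Real.sin a ^ 2 - Real.sin b ^ 2| ≤ |a - b| := by
  have h : Real.sin a ^ 2 - Real.sin b ^ 2 = Real.sin (a + b) * Real.sin (a - b) := by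
    rw [Real.sin_add, Real.sin_sub]
    linear_combination Real.sin b ^ 2 * Real.sin_sq_add_cos_sq a -
      Real.sin a ^ 2 * Real.sin_sq_add_cos_sq b
  rw [h, abs_mul]
  calc |Real.sin (a + b)| * |Real.sin (a - b)| ≤ 1 * |a - b| :=
        mul_le_mul (Real.abs_sin_le_one _) Real.abs_sin_le_abs (abs_nonneg _) zero_le_one
    _ = |a - b| := one_mul _

theorem lipschitzWith_prufer {c : ℝ} {M : NNReal} (hc : |c| ≤ M) :
    LipschitzWith M (fun y => 1 + c * Real.sin y ^ 2) := by
  refine LipschitzWith.of_dist_le_mul fun a b => ?_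
  rw [Real.dist_eq, Real.dist_eq]
  have : (1 + c * Real.sin a ^ 2) - (1 + c * Real.sin b ^ 2) =
      c * (Real.sin a ^ 2 - Real.sin b ^ 2) := by ring
  rw [this, abs_mul]
  exact mul_le_mul hc (Real.abs_sin_sq_sub_sin_sq_le a b) (abs_nonneg _) M.2

theorem exists_pruferAngle {Q : ℝ → ℝ} (hQ : Continuous Q) (hb : ∃ M, ∀ x, |Q x| ≤ M)
    (θ₀ : ℝ) : ∃ θ, IsPruferAngle Q θ ∧ θ 0 = θ₀ := by
  obtain ⟨M, hM⟩ := hb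
  have hM0 : 0 ≤ M := (abs_nonneg _).trans (hM 0)
  have h1 : ∀ t, |Q t - 1| ≤ M + 1 := fun t => by
    have := abs_le.mp (hM t)
    rw [abs_le]; constructor <;> linarith
  obtain ⟨θ, h0, hθ⟩ := exists_global_solution_of_bounded
    (v := fun t y => 1 + (Q t - 1) * Real.sin y ^ 2) (K := ⟨M + 1, by linarith⟩)
    (M := ⟨M + 2, by linarith⟩) (fun t => lipschitzWith_prufer (h1 t)) (fun y => by fun_prop)
    (fun t y => by
      have h2 : |Real.sin y ^ 2| ≤ 1 := by
        rw [abs_of_nonneg (sq_nonneg _)]; exact Real.sin_sq_le_one y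
      calc ‖1 + (Q t - 1) * Real.sin y ^ 2‖ ≤ ‖(1 : ℝ)‖ + ‖(Q t - 1) * Real.sin y ^ 2‖ :=
            norm_add_le _ _
        _ ≤ 1 + (M + 1) * 1 := by
            rw [norm_one, norm_mul]
            gcongr
            · exact h1 t
            · exact h2
        _ = M + 2 := by ring) θ₀
  exact ⟨θ, hθ, h0⟩

theorem IsPruferAngle.eq_of_eq {Q θ₁ θ₂ : ℝ → ℝ} (hb : ∃ M, ∀ x, |Q x| ≤ M)
    (h₁ : IsPruferAngle Q θ₁) (h₂ : IsPruferAngle Q θ₂) {a : ℝ} (h0 : θ₁ a = θ₂ a) : θ₁ = θ₂ := by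
  obtain ⟨M, hM⟩ := hb
  have hM0 : 0 ≤ M := (abs_nonneg _).trans (hM 0)
  exact ODE_solution_unique_univ (v := fun t y => 1 + (Q t - 1) * Real.sin y ^ 2)
    (s := fun _ => Set.univ) (K := ⟨M + 1, by linarith⟩) (t₀ := a)
    (fun t => (lipschitzWith_prufer (by
      have := abs_le.mp (hM t)
      show |Q t - 1| ≤ M + 1
      rw [abs_le]; constructor <;> linarith)).lipschitzOnWith)
    (fun t => ⟨h₁ t, trivial⟩) (fun t => ⟨h₂ t, trivial⟩) h0

theorem IsPruferAngle.continuous {Q θ : ℝ → ℝ} (h : IsPruferAngle Q θ) : Continuous θ :=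
  continuous_iff_continuousAt.mpr fun x => (h x).continuousAt

/-- The angle equation is autonomous of the amplitude, which is recovered from r'/r = (1 - Q) sin θ
cos θ. -/
theorem IsPruferAngle.exists_radius {Q θ : ℝ → ℝ} (hQ : Continuous Q) (h : IsPruferAngle Q θ) :
    ∃ r : ℝ → ℝ, (∀ x, 0 < r x) ∧ r 0 = 1 ∧
      IsLinearSolution Q (fun x => r x * Real.sin (θ x)) (fun x => r x * Real.cos (θ x)) := by
  have hθ := h.continuous
  have hg : Continuous fun x => (1 - Q x) * (Real.sin (θ x) * Real.cos (θ x)) := by fun_prop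
  have hr : ∀ x, HasDerivAt
      (fun x => Real.exp (∫ t in (0 : ℝ)..x, (1 - Q t) * (Real.sin (θ t) * Real.cos (θ t))))
      (Real.exp (∫ t in (0 : ℝ)..x, (1 - Q t) * (Real.sin (θ t) * Real.cos (θ t))) *
        ((1 - Q x) * (Real.sin (θ x) * Real.cos (θ x)))) x := fun x =>
    (intervalIntegral.integral_hasDerivAt_right (hg.intervalIntegrable _ _)
      (hg.stronglyMeasurableAtFilter _ _) hg.continuousAt).exp
  refine ⟨fun x => Real.exp
    (∫ t in (0 : ℝ)..x, (1 - Q t) * (Real.sin (θ t) * Real.cos (θ t))),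
    fun x => Real.exp_pos _, by simp, fun x => ?_, fun x => ?_⟩
  · refine ((hr x).mul (h x).sin).congr_deriv ?_
    ring
  · refine ((hr x).mul (h x).cos).congr_deriv ?_
    linear_combination ((1 - Q x) * Real.sin (θ x) * Real.exp
      (∫ t in (0 : ℝ)..x, (1 - Q t) * (Real.sin (θ t) * Real.cos (θ t)))) *
        Real.sin_sq_add_cos_sq (θ x)

/-! ### Wronskian, reflection and translation of linear solutions -/

namespace IsLinearSolution

variable {Q f f' g g' : ℝ → ℝ}

theorem continuous (h : IsLinearSolution Q f f') : Continuous f :=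
  continuous_iff_continuousAt.mpr fun x => (h.hasDerivAt x).continuousAt

theorem continuous' (h : IsLinearSolution Q f f') : Continuous f' :=
  continuous_iff_continuousAt.mpr fun x => (h.hasDerivAt' x).continuousAt

theorem wronskian (hf : IsLinearSolution Q f f') (hg : IsLinearSolution Q g g') (x y : ℝ) :
    f x * g' x - f' x * g x = f y * g' y - f' y * g y := by
  have hd : ∀ x, HasDerivAt (fun x => f x * g' x - f' x * g x) 0 x := fun x => by
    refine (((hf.hasDerivAt x).mul (hg.hasDerivAt' x)).sub
      ((hf.hasDerivAt' x).mul (hg.hasDerivAt x))).congr_deriv ?_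
    ring
  exact is_const_of_deriv_eq_zero (fun x => (hd x).differentiableAt) (fun x => (hd x).deriv) x y

theorem comp_neg (hf : IsLinearSolution Q f f') (hQ : ∀ x, Q (-x) = Q x) :
    IsLinearSolution Q (fun x => f (-x)) (fun x => -f' (-x)) :=
  ⟨fun x => by
    have := (hf.hasDerivAt (-x)).comp x (hasDerivAt_neg x)
    simpa [Function.comp_def] using this, fun x => by
    have := ((hf.hasDerivAt' (-x)).comp x (hasDerivAt_neg x)).neg
    simp only [hQ] at this
    exact this.congr_deriv (by ring)⟩

theorem comp_add (hf : IsLinearSolution Q f f') {T : ℝ} (hQ : ∀ x, Q (x + T) = Q x) :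
    IsLinearSolution Q (fun x => f (x + T)) (fun x => f' (x + T)) :=
  ⟨fun x => (hf.hasDerivAt (x + T)).comp_add_const x T, fun x => by
    have := (hf.hasDerivAt' (x + T)).comp_add_const x T
    rwa [hQ] at this⟩

end IsLinearSolution

namespace IsFundamental

variable {Q φ φ' ψ ψ' f f' : ℝ → ℝ}

theorem wronskian_eq_one (h : IsFundamental Q φ φ' ψ ψ') (x : ℝ) :
    φ x * ψ' x - φ' x * ψ x = 1 := by
  rw [h.left.wronskian h.right x 0, h.left_zero, h.left_zero', h.right_zero, h.right_zero']
  ring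

/-- Cramer's rule: the Wronskians of f with φ and with ψ are constant and known at the origin. -/
theorem eq_combination (h : IsFundamental Q φ φ' ψ ψ') (hf : IsLinearSolution Q f f') (x : ℝ) :
    f x = f 0 * φ x + f' 0 * ψ x ∧ f' x = f 0 * φ' x + f' 0 * ψ' x := by
  have h1 := hf.wronskian h.left x 0
  have h2 := hf.wronskian h.right x 0
  rw [h.left_zero, h.left_zero'] at h1
  rw [h.right_zero, h.right_zero'] at h2
  have h3 := h.wronskian_eq_one x
  constructor
  · linear_combination (-f x) * h3 - ψ x * h1 + φ x * h2
  · linear_combination (-f' x) * h3 - ψ' x * h1 + φ' x * h2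

theorem left_neg (h : IsFundamental Q φ φ' ψ ψ') (hQ : ∀ x, Q (-x) = Q x) (x : ℝ) :
    φ (-x) = φ x ∧ φ' (-x) = -φ' x := by
  have := h.eq_combination (h.left.comp_neg hQ) x
  simp only [neg_zero, h.left_zero, h.left_zero'] at this
  exact ⟨by linarith [this.1], by linarith [this.2]⟩

theorem right_neg (h : IsFundamental Q φ φ' ψ ψ') (hQ : ∀ x, Q (-x) = Q x) (x : ℝ) :
    ψ (-x) = -ψ x ∧ ψ' (-x) = ψ' x := by
  have := h.eq_combination (h.right.comp_neg hQ) x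
  simp only [neg_zero, h.right_zero, h.right_zero'] at this
  exact ⟨by linarith [this.1], by linarith [this.2]⟩

theorem left_add (h : IsFundamental Q φ φ' ψ ψ') {T : ℝ} (hQ : ∀ x, Q (x + T) = Q x) (x : ℝ) :
    φ (x + T) = φ T * φ x + φ' T * ψ x ∧ φ' (x + T) = φ T * φ' x + φ' T * ψ' x := by
  simpa using h.eq_combination (h.left.comp_add hQ) x

theorem right_add (h : IsFundamental Q φ φ' ψ ψ') {T : ℝ} (hQ : ∀ x, Q (x + T) = Q x) (x : ℝ) :
    ψ (x + T) = ψ T * φ x + ψ' T * ψ x ∧ ψ' (x + T) = ψ T * φ' x + ψ' T * ψ' x := by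
  simpa using h.eq_combination (h.right.comp_add hQ) x

end IsFundamental

/-! ### The stationary wave: energy, uniqueness, symmetries -/

theorem exists_first_zero {f : ℝ → ℝ} {a b : ℝ} (hab : a ≤ b) (hf : ContinuousOn f (Set.Icc a b))
    (ha : 0 < f a) (hb : f b ≤ 0) :
    ∃ y ∈ Set.Ioc a b, f y = 0 ∧ ∀ x ∈ Set.Ico a y, 0 < f x := by
  have hcl : IsClosed {x ∈ Set.Icc a b | f x ≤ 0} :=
    hf.preimage_isClosed_of_isClosed isClosed_Icc isClosed_Iic
  have hcp : IsCompact {x ∈ Set.Icc a b | f x ≤ 0} :=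
    isCompact_Icc.of_isClosed_subset hcl fun x hx => hx.1
  obtain ⟨y, ⟨hy, hfy⟩, hmin⟩ := hcp.exists_isLeast ⟨b, ⟨hab, le_rfl⟩, hb⟩
  have hay : a < y := lt_of_le_of_ne hy.1 fun h => by rw [← h] at hfy; linarith
  have hpos : ∀ x ∈ Set.Ico a y, 0 < f x := fun x hx => by
    by_contra hc
    exact absurd (hmin ⟨⟨hx.1, hx.2.le.trans hy.2⟩, not_lt.mp hc⟩) (not_le.mpr hx.2)
  refine ⟨y, ⟨hay, hy.2⟩, ?_, hpos⟩
  obtain ⟨z, hz, hfz⟩ := intermediate_value_Icc' hy.1 (hf.mono (Set.Icc_subset_Icc_right hy.2))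
    ⟨hfy, ha.le⟩
  rcases eq_or_lt_of_le hz.2 with h | h
  · rwa [← h]
  · exact absurd hfz (hpos z ⟨hz.1, h⟩).ne'

theorem pos_of_ne_zero_of_continuousOn {f : ℝ → ℝ} {a b : ℝ} (hf : ContinuousOn f (Set.Icc a b))
    (ha : 0 < f a) (hne : ∀ x ∈ Set.Icc a b, f x ≠ 0) : ∀ x ∈ Set.Icc a b, 0 < f x := by
  intro x hx
  by_contra hc
  obtain ⟨y, hy, h0, -⟩ := exists_first_zero hx.1 (hf.mono (Set.Icc_subset_Icc_right hx.2)) ha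
    (not_lt.mp hc)
  exact hne y ⟨hy.1.le, hy.2.trans hx.2⟩ h0

theorem hasDerivAt_abs_rpow_mul_self {s : ℝ} (hs : 0 < s) (x : ℝ) :
    HasDerivAt (fun x : ℝ => |x| ^ s * x) ((s + 1) * |x| ^ s) x := by
  rcases eq_or_ne x 0 with rfl | hx
  · rw [hasDerivAt_iff_tendsto_slope]
    have h : Filter.Tendsto (fun y : ℝ => |y| ^ s) (nhdsWithin 0 {0}ᶜ) (nhds (|0| ^ s)) :=
      ((continuous_abs.rpow_const fun _ => Or.inr hs.le).tendsto 0).mono_left nhdsWithin_le_nhds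
    simp only [abs_zero, Real.zero_rpow hs.ne', mul_zero] at h ⊢
    refine h.congr' ?_
    filter_upwards [self_mem_nhdsWithin] with y hy
    have hy' : y ≠ 0 := hy
    simp [slope_def_field, hy']
  · have h1 := ((hasDerivAt_abs hx).rpow_const (p := s) (Or.inl (abs_ne_zero.mpr hx))).mul
      (hasDerivAt_id x)
    refine h1.congr_deriv ?_
    have h2 : (SignType.sign x : ℝ) * x = |x| := sign_mul_self x
    have h3 : |x| ^ s = |x| ^ (s - 1) * |x| := by
      rw [← Real.rpow_add_one (abs_ne_zero.mpr hx)]; congr 1; ring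
    simp only [id, mul_one]
    rw [h3]
    linear_combination (s * |x| ^ (s - 1)) * h2

/-- The pair `(u, u')` solves the stationary equation `-u'' - (p+1)|u|^{2p} u = ω u`. -/
def IsProfile (p ω : ℝ) (u u' : ℝ → ℝ) : Prop :=
  IsLinearSolution (fun x => ω + (p + 1) * |u x| ^ (2 * p)) u u'

namespace IsProfile

variable {p ω : ℝ} {u u' v v' : ℝ → ℝ}

theorem neg (h : IsProfile p ω u u') : IsProfile p ω (fun x => -u x) (fun x => -u' x) :=
  ⟨fun x => (h.hasDerivAt x).neg, fun x => ((h.hasDerivAt' x).neg).congr_deriv (by simp)⟩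

theorem comp_add (h : IsProfile p ω u u') (T : ℝ) :
    IsProfile p ω (fun x => u (x + T)) (fun x => u' (x + T)) :=
  ⟨fun x => (h.hasDerivAt (x + T)).comp_add_const x T,
    fun x => (h.hasDerivAt' (x + T)).comp_add_const x T⟩

theorem comp_neg (h : IsProfile p ω u u') :
    IsProfile p ω (fun x => u (-x)) (fun x => -u' (-x)) :=
  ⟨fun x => by
    have := (h.hasDerivAt (-x)).comp x (hasDerivAt_neg x)
    simpa [Function.comp_def] using this, fun x => by
    have := ((h.hasDerivAt' (-x)).comp x (hasDerivAt_neg x)).neg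
    exact this.congr_deriv (by ring)⟩

theorem energy (hp : 0 < p) (h : IsProfile p ω u u') (x y : ℝ) :
    u' x ^ 2 + ω * u x ^ 2 + |u x| ^ (2 * p + 2) = u' y ^ 2 + ω * u y ^ 2 + |u y| ^ (2 * p + 2) := by
  have hd : ∀ x, HasDerivAt (fun x => u' x ^ 2 + ω * u x ^ 2 + |u x| ^ (2 * p + 2)) 0 x := by
    intro x
    have h1 := (hasDerivAt_abs_rpow (u x) (p := 2 * p + 2) (by linarith)).comp x (h.hasDerivAt x)
    refine ((((h.hasDerivAt' x).pow 2).add (((h.hasDerivAt x).pow 2).const_mul ω)).add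
      h1).congr_deriv ?_
    have : 2 * p + 2 - 2 = 2 * p := by ring
    rw [this]
    ring
  exact is_const_of_deriv_eq_zero (fun x => (hd x).differentiableAt) (fun x => (hd x).deriv) x y

theorem hasDerivAt_force (hp : 0 < p) (s : ℝ) :
    HasDerivAt (fun s => -((ω + (p + 1) * |s| ^ (2 * p)) * s))
      (-(ω + (2 * p + 1) * (p + 1) * |s| ^ (2 * p))) s := by
  have h1 := (((hasDerivAt_id s).const_mul ω).add
    ((hasDerivAt_abs_rpow_mul_self (s := 2 * p) (by linarith) s).const_mul (p + 1))).neg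
  refine (h1.congr_deriv (by ring)).congr_of_eventuallyEq (Filter.Eventually.of_forall fun y => ?_)
  simp only [id, Pi.neg_apply, Pi.add_apply]
  ring

/-- The force is C¹ for p > 0, hence Lipschitz on the bounded range of both solutions over a compact
time interval. All symmetries of the wave are deduced from this. -/
theorem unique (hp : 0 < p) (hu : IsProfile p ω u u') (hv : IsProfile p ω v v') {a : ℝ}
    (h0 : u a = v a) (h1 : u' a = v' a) (x : ℝ) : u x = v x ∧ u' x = v' x := by
  set R := |x - a| + 1
  have hR : 0 < R := by positivity
  obtain ⟨B₁, hB₁⟩ := isCompact_Icc.exists_bound_of_continuousOn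
    (IsLinearSolution.continuous hu).continuousOn (s := Set.Icc (a - R) (a + R))
  obtain ⟨B₂, hB₂⟩ := isCompact_Icc.exists_bound_of_continuousOn
    (IsLinearSolution.continuous hv).continuousOn (s := Set.Icc (a - R) (a + R))
  set B := max B₁ B₂
  set F : ℝ → ℝ := fun s => -((ω + (p + 1) * |s| ^ (2 * p)) * s)
  obtain ⟨K, hK⟩ : ∃ K : NNReal, LipschitzOnWith K F (Metric.closedBall 0 B) := by
    have hc : Continuous fun s : ℝ => -(ω + (2 * p + 1) * (p + 1) * |s| ^ (2 * p)) := by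
      have : Continuous fun s : ℝ => |s| ^ (2 * p) :=
        continuous_abs.rpow_const fun _ => Or.inr (by linarith)
      fun_prop
    obtain ⟨K, hK⟩ := (isCompact_closedBall (0 : ℝ) B).exists_bound_of_continuousOn hc.continuousOn
    refine ⟨K.toNNReal, (convex_closedBall 0 B).lipschitzOnWith_of_nnnorm_hasDerivWithin_le
      (fun s _ => (hasDerivAt_force hp s).hasDerivWithinAt) fun s hs => ?_⟩
    rw [← NNReal.coe_le_coe, coe_nnnorm]
    exact (hK s hs).trans (Real.le_coe_toNNReal K)
  have hlip : ∀ t ∈ Set.Ioo (a - R) (a + R),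
      LipschitzOnWith (max 1 K) (fun y : ℝ × ℝ => (y.2, F y.1))
        (Metric.closedBall 0 B ×ˢ Set.univ) := fun t _ => by
    refine (LipschitzWith.prod_snd.lipschitzOnWith).prodMk ?_
    have := hK.comp (LipschitzWith.prod_fst.lipschitzOnWith
      (s := (Metric.closedBall (0 : ℝ) B ×ˢ (Set.univ : Set ℝ)))) (fun y hy => hy.1)
    simpa [Function.comp_def] using this
  have hx : x ∈ Set.Ioo (a - R) (a + R) := by
    have := abs_lt.mp (lt_add_one |x - a|)
    constructor <;> linarith [this.1, this.2]
  have key := ODE_solution_unique_of_mem_Ioo (v := fun (_ : ℝ) (y : ℝ × ℝ) => (y.2, F y.1))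
    (s := fun _ => Metric.closedBall 0 B ×ˢ Set.univ) (t₀ := a)
    (f := fun t => (u t, u' t)) (g := fun t => (v t, v' t)) hlip
    ⟨by linarith, by linarith⟩
    (fun t ht => ⟨(hu.hasDerivAt t).prodMk (hu.hasDerivAt' t), ?_, trivial⟩)
    (fun t ht => ⟨(hv.hasDerivAt t).prodMk (hv.hasDerivAt' t), ?_, trivial⟩)
    (by simp [h0, h1]) hx
  · simpa using key
  · exact mem_closedBall_zero_iff.mpr ((hB₁ t (Set.Ioo_subset_Icc_self ht)).trans (le_max_left _ _))
  · exact mem_closedBall_zero_iff.mpr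
      ((hB₂ t (Set.Ioo_subset_Icc_self ht)).trans (le_max_right _ _))

end IsProfile

/-- A profile that is odd, antiperiodic with antiperiod `T`, positive on `(0, T)` and increasing
on `[0, T / 2)`. -/
structure IsHalfWave (p ω T : ℝ) (u u' : ℝ → ℝ) : Prop where
  profile : IsProfile p ω u u'
  pos_T : 0 < T
  odd : ∀ x, u (-x) = -u x
  antiperiodic : ∀ x, u (x + T) = -u x
  pos : ∀ x ∈ Set.Ioo 0 T, 0 < u x
  deriv_pos : ∀ x ∈ Set.Ico 0 (T / 2), 0 < u' x

/-- At the first positive zero z, energy gives u'(z) = -u'(0), so uniqueness makes u antiperiodic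
with antiperiod z. Then 2z is a period, and minimality of 2T forces z = T. -/
theorem IsProfile.isHalfWave {p ω T : ℝ} {u u' : ℝ → ℝ} (hp : 0 < p) (h : IsProfile p ω u u')
    (hT : 0 < T) (hodd : ∀ x, u (-x) = -u x)
    (hper : IsLeast {τ : ℝ | 0 < τ ∧ Function.Periodic u τ} (2 * T)) (h0 : 0 < u' 0) :
    IsHalfWave p ω T u u' := by
  have hu0 : u 0 = 0 := by have := hodd 0; rw [neg_zero] at this; linarith
  have huT : u T = 0 := by
    have h1 := hper.1.2 (-T)
    rw [show -T + 2 * T = T by ring, hodd] at h1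
    linarith
  have hcont := IsLinearSolution.continuous h
  have hcont' := IsLinearSolution.continuous' h
  obtain ⟨δ, hδ, hδT, hδpos⟩ : ∃ δ, 0 < δ ∧ δ < T ∧ ∀ x ∈ Set.Ioc 0 δ, 0 < u x := by
    obtain ⟨e, he, hepos⟩ := Metric.eventually_nhds_iff.mp
      ((hcont'.tendsto 0).eventually (lt_mem_nhds h0))
    refine ⟨min (e / 2) (T / 2), by positivity, by linarith [min_le_right (e / 2) (T / 2)],
      fun x hx => ?_⟩
    have hmono : StrictMonoOn u (Set.Icc 0 x) := by
      refine strictMonoOn_of_deriv_pos (convex_Icc _ _) hcont.continuousOn fun y hy => ?_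
      rw [(h.hasDerivAt y).deriv]
      rw [interior_Icc] at hy
      apply hepos
      rw [Real.dist_eq, sub_zero, abs_of_pos hy.1]
      linarith [hy.2, hx.2, min_le_left (e / 2) (T / 2)]
    have := hmono ⟨le_rfl, hx.1.le⟩ ⟨hx.1.le, le_rfl⟩ hx.1
    rwa [hu0] at this
  obtain ⟨z, hz, huz, hzpos'⟩ := exists_first_zero hδT.le hcont.continuousOn
    (hδpos δ ⟨hδ, le_rfl⟩) huT.le
  have hzpos : ∀ x ∈ Set.Ioo 0 z, 0 < u x := fun x hx => by
    rcases le_or_gt x δ with hxd | hxd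
    · exact hδpos x ⟨hx.1, hxd⟩
    · exact hzpos' x ⟨hxd.le, hx.2⟩
  have hz0 : 0 < z := hδ.trans hz.1
  have huz' : u' z ≤ 0 := by
    by_contra hc
    have hd := (h.hasDerivAt z)
    have := hd.tendsto_slope.eventually (lt_mem_nhds (not_le.mp hc))
    have h2 : ∀ᶠ x in nhdsWithin z (Set.Iio z), 0 < slope u z x :=
      this.filter_mono (nhdsWithin_mono _ fun x hx => ne_of_lt hx)
    have h3 : ∀ᶠ x in nhdsWithin z (Set.Iio z), x ∈ Set.Ioo 0 z := Ioo_mem_nhdsLT hz0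
    obtain ⟨x, hx1, hx2⟩ := (h2.and h3).exists
    rw [slope_def_field, huz, sub_zero] at hx1
    have := hzpos x hx2
    exact absurd hx1 (not_lt.mpr (div_nonpos_of_nonneg_of_nonpos this.le (by linarith [hx2.2])))
  have hzz : u' z = -u' 0 := by
    have he := h.energy hp z 0
    rw [huz, hu0] at he
    have h2 : (u' z - u' 0) * (u' z + u' 0) = 0 := by linear_combination he
    rcases mul_eq_zero.mp h2 with h3 | h3 <;> linarith
  have hanti : ∀ x, u (x + z) = -u x := fun x =>
    ((h.comp_add z).unique hp h.neg (a := 0) (by simp [hu0, huz]) (by simp [hzz]) x).1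
  have hzT : z = T := by
    have := hper.2 (show 2 * z ∈ {τ : ℝ | 0 < τ ∧ Function.Periodic u τ} from
      ⟨by linarith, fun x => by rw [two_mul, ← add_assoc, hanti, hanti, neg_neg]⟩)
    linarith [hz.2]
  subst hzT
  refine ⟨h, hT, hodd, hanti, hzpos, ?_⟩
  intro x hx
  refine pos_of_ne_zero_of_continuousOn hcont'.continuousOn h0 (fun y hy hy0 => ?_) x
    (⟨hx.1, le_rfl⟩ : x ∈ Set.Icc 0 x)
  have hy1 : 0 < y := lt_of_le_of_ne hy.1 fun hc => by rw [← hc] at hy0; linarith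
  -- A critical point y is a centre of reflection, so u(2y) = u(0) = 0, impossible for 0 < 2y < T.
  have hsym := (h.comp_add y).unique hp (h.comp_add y).comp_neg (a := 0) (by simp)
    (by simp [hy0]) y
  have h3 : u (y + y) = 0 := by simpa [hu0] using hsym.1
  exact absurd h3 (hzpos (y + y) ⟨by linarith, by linarith [hy.2, hx.2]⟩).ne'

namespace IsHalfWave

variable {p ω T : ℝ} {u u' : ℝ → ℝ}

theorem zero (h : IsHalfWave p ω T u u') : u 0 = 0 := by
  have := h.odd 0
  rw [neg_zero] at this
  linarith

theorem even_deriv (h : IsHalfWave p ω T u u') (x : ℝ) : u' (-x) = u' x := by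
  have h1 := (IsLinearSolution.hasDerivAt h.profile.comp_neg x)
  have h2 := (h.profile.hasDerivAt x).neg
  have h3 : (fun x => u (-x)) = -u := funext fun y => h.odd y
  rw [h3] at h1
  have := h1.unique h2
  linarith

theorem antiperiodic_deriv (h : IsHalfWave p ω T u u') (x : ℝ) : u' (x + T) = -u' x := by
  have h1 := (h.profile.comp_add T).hasDerivAt x
  have h3 : (fun x => u (x + T)) = -u := funext fun y => h.antiperiodic y
  rw [h3] at h1
  exact h1.unique (h.profile.hasDerivAt x).neg

theorem deriv_half (h : IsHalfWave p ω T u u') : u' (T / 2) = 0 := by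
  have := h.antiperiodic_deriv (-(T / 2))
  rw [h.even_deriv, show -(T / 2) + T = T / 2 by ring] at this
  linarith

end IsHalfWave

/-- Replacing u by -u when u'(0) < 0 treats both signs at once, as the potentials see only |u|. If
u'(0) = 0, then u vanishes identically and has no minimal period. -/
theorem IsRingState.exists_isHalfWave {p L ω : ℝ} {n : ℕ} {u : ℝ → ℝ} (hp : 0 < p) (hL : 0 < L)
    (hn : 1 ≤ n) (h : IsRingState p L n ω u) :
    ∃ v v', IsHalfWave p ω (L / n) v v' ∧ ∀ x, |u x| = |v x| := by
  have hn0 : (0 : ℝ) < n := by exact_mod_cast hn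
  have hprof : IsProfile p ω u (deriv u) := by
    have hd : Differentiable ℝ u := h.contDiff.differentiable (by norm_num)
    have hd' : Differentiable ℝ (deriv u) :=
      ((contDiff_succ_iff_deriv (n := 1)).mp h.contDiff).2.2.differentiable (by norm_num)
    exact ⟨fun x => (hd x).hasDerivAt, fun x => (hd' x).hasDerivAt.congr_deriv (by
      linear_combination -(h.equation x))⟩
  have hper : IsLeast {τ : ℝ | 0 < τ ∧ Function.Periodic u τ} (2 * (L / n)) := by
    rw [← mul_div_assoc]; exact h.period
  have hu0 : u 0 = 0 := by have := h.odd 0; rw [neg_zero] at this; linarith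
  have hne : deriv u 0 ≠ 0 := fun h0 => by
    have hz : IsProfile p ω (fun _ => 0) (fun _ => 0) :=
      ⟨fun x => hasDerivAt_const x 0, fun x => (hasDerivAt_const x (0 : ℝ)).congr_deriv (by simp)⟩
    have hzero : ∀ x, u x = 0 := fun x => (hprof.unique hp hz (a := 0) hu0 h0 x).1
    have hpos : 0 < L / n := div_pos hL hn0
    have := hper.2 (show L / n ∈ {τ : ℝ | 0 < τ ∧ Function.Periodic u τ} from
      ⟨hpos, fun x => by rw [hzero, hzero]⟩)
    linarith
  rcases lt_or_gt_of_ne hne with hlt | hgt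
  · refine ⟨_, _, hprof.neg.isHalfWave hp (div_pos hL hn0) (fun x => by simp [h.odd]) ?_
      (by simpa using hlt), fun x => (abs_neg _).symm⟩
    convert hper using 3
    simp [Function.Periodic]
  · exact ⟨_, _, hprof.isHalfWave hp (div_pos hL hn0) h.odd hper hgt, fun x => rfl⟩

/-! ### The gap inequality: sign of φφ' where ψ vanishes -/

namespace IsFundamental

variable {Q φ φ' ψ ψ' : ℝ → ℝ}

/-- Where Q < 0, (φφ')' = φ'² - Qφ² ≥ 0 keeps φ² ≥ 1, so φ stays positive and convex; (ψ/φ)' = 1/φ²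
then handles ψ. -/
theorem pos_of_neg (h : IsFundamental Q φ φ' ψ ψ') {b : ℝ} (hb : 0 < b)
    (hQ : ∀ x ∈ Set.Ico 0 b, Q x < 0) : 0 < φ b ∧ 0 < φ' b ∧ 0 < ψ b ∧ 0 < ψ' b := by
  have hm0 : (0 : ℝ) ∈ Set.Icc 0 b := ⟨le_rfl, hb.le⟩
  have hmb : b ∈ Set.Icc 0 b := ⟨hb.le, le_rfl⟩
  have hprod : ∀ x ∈ Set.Icc 0 b, 0 ≤ φ x * φ' x := fun x hx => by
    have hd : ∀ x, HasDerivAt (fun x => φ x * φ' x) (φ' x ^ 2 - Q x * φ x ^ 2) x := fun x =>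
      ((h.left.hasDerivAt x).mul (h.left.hasDerivAt' x)).congr_deriv (by ring)
    have hmono : MonotoneOn (fun x => φ x * φ' x) (Set.Icc 0 b) :=
      monotoneOn_of_deriv_nonneg (convex_Icc _ _)
        (h.left.continuous.mul h.left.continuous').continuousOn
        (fun x _ => (hd x).differentiableAt.differentiableWithinAt) fun x hx => by
          rw [interior_Icc] at hx
          rw [(hd x).deriv]
          nlinarith [hQ x ⟨hx.1.le, hx.2⟩, sq_nonneg (φ x), sq_nonneg (φ' x)]
    simpa [h.left_zero'] using hmono hm0 hx hx.1
  have hsq : ∀ x ∈ Set.Icc 0 b, 1 ≤ φ x ^ 2 := fun x hx => by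
    have hd : ∀ x, HasDerivAt (fun x => φ x ^ 2) (2 * (φ x * φ' x)) x := fun x =>
      ((h.left.hasDerivAt x).pow 2).congr_deriv (by ring)
    have hmono : MonotoneOn (fun x => φ x ^ 2) (Set.Icc 0 b) :=
      monotoneOn_of_deriv_nonneg (convex_Icc _ _) (h.left.continuous.pow 2).continuousOn
        (fun x _ => (hd x).differentiableAt.differentiableWithinAt) fun x hx => by
          rw [interior_Icc] at hx
          rw [(hd x).deriv]
          exact mul_nonneg zero_le_two (hprod x (Set.Ioo_subset_Icc_self hx))
    simpa [h.left_zero] using hmono hm0 hx hx.1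
  have hφ : ∀ x ∈ Set.Icc 0 b, 0 < φ x :=
    pos_of_ne_zero_of_continuousOn h.left.continuous.continuousOn (by simp [h.left_zero])
      fun x hx h0 => by have := hsq x hx; rw [h0] at this; norm_num at this
  have hφ' : 0 < φ' b := by
    have hmono : StrictMonoOn φ' (Set.Icc 0 b) :=
      strictMonoOn_of_deriv_pos (convex_Icc _ _) h.left.continuous'.continuousOn fun x hx => by
        rw [interior_Icc] at hx
        rw [(h.left.hasDerivAt' x).deriv]
        nlinarith [hQ x ⟨hx.1.le, hx.2⟩, hφ x (Set.Ioo_subset_Icc_self hx)]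
    simpa [h.left_zero'] using hmono hm0 hmb hb
  have hψ : 0 < ψ b := by
    have hmono : StrictMonoOn (fun x => ψ x / φ x) (Set.Icc 0 b) :=
      strictMonoOn_of_deriv_pos (convex_Icc _ _)
        (h.right.continuous.continuousOn.div h.left.continuous.continuousOn
          fun x hx => (hφ x hx).ne') fun x hx => by
        rw [interior_Icc] at hx
        have hx0 := hφ x (Set.Ioo_subset_Icc_self hx)
        have hd := (h.right.hasDerivAt x).div (h.left.hasDerivAt x) hx0.ne'
        have hw := h.wronskian_eq_one x
        have he : deriv (fun x => ψ x / φ x) x = 1 / φ x ^ 2 := by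
          rw [← hw]
          refine (hd.congr_deriv ?_).deriv
          ring
        rw [he]
        positivity
    have := hmono hm0 hmb hb
    simp only [h.right_zero, zero_div] at this
    exact (div_pos_iff_of_pos_right (hφ b hmb)).mp this
  refine ⟨hφ b hmb, hφ', hψ, ?_⟩
  have hw := h.wronskian_eq_one b
  have : 0 < φ b * ψ' b := by nlinarith [mul_pos hφ' hψ]
  exact (mul_pos_iff_of_pos_left (hφ b hmb)).mp this

/-- The values over one period of an even periodic potential, in terms of half a period. -/
theorem period_eq_half (h : IsFundamental Q φ φ' ψ ψ') {T : ℝ} (hQ : ∀ x, Q (-x) = Q x)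
    (hQT : ∀ x, Q (x + T) = Q x) :
    φ T = φ (T / 2) * ψ' (T / 2) + ψ (T / 2) * φ' (T / 2) ∧ φ' T = 2 * (φ (T / 2) * φ' (T / 2)) ∧
      ψ T = 2 * (ψ (T / 2) * ψ' (T / 2)) := by
  have e : -(T / 2) + T = T / 2 := by ring
  obtain ⟨l1, l2⟩ := h.left_add hQT (-(T / 2))
  obtain ⟨r1, r2⟩ := h.right_add hQT (-(T / 2))
  rw [e, (h.left_neg hQ _).1, (h.right_neg hQ _).1] at l1 r1
  rw [e, (h.left_neg hQ _).2, (h.right_neg hQ _).2] at l2 r2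
  have hw := h.wronskian_eq_one (T / 2)
  refine ⟨?_, ?_, ?_⟩
  · linear_combination (-φ T) * hw - ψ' (T / 2) * l1 - ψ (T / 2) * l2
  · linear_combination (-φ' T) * hw - φ' (T / 2) * l1 - φ (T / 2) * l2
  · linear_combination (-ψ T) * hw - ψ' (T / 2) * r1 - ψ (T / 2) * r2

/-- Translations by T and by nT commute, so ψ(nT) = 0 gives φ'(nT)ψ(T) = 0. Either φ'(nT) = 0, or
ψ(T) = 0 and the monodromy is triangular, so the sign propagates by induction. -/
theorem mul_nonneg_of_right_eq_zero (h : IsFundamental Q φ φ' ψ ψ') {T : ℝ}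
    (hQT : ∀ x, Q (x + T) = Q x) (hT : ψ T = 0 → 0 ≤ φ T * φ' T) (n : ℕ) (hn : ψ (n * T) = 0) :
    0 ≤ φ (n * T) * φ' (n * T) := by
  have hQn : ∀ (j : ℕ) x, Q (x + j * T) = Q x := fun j => by
    induction j with
    | zero => simp
    | succ j ih => intro x; rw [Nat.cast_succ, add_mul, one_mul, ← add_assoc, hQT, ih]
  rcases eq_or_ne (ψ T) 0 with h0 | h0
  · have key : ∀ j : ℕ, ψ (j * T) = 0 ∧ 0 ≤ φ (j * T) * φ' (j * T) := fun j => by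
      induction j with
      | zero => simp [h.right_zero, h.left_zero']
      | succ j ih =>
        have e : ((j + 1 : ℕ) : ℝ) * T = j * T + T := by push_cast; ring
        have hw := h.wronskian_eq_one (j * T)
        rw [e, (h.right_add hQT _).1, (h.left_add hQT _).1, (h.left_add hQT _).2, h0, ih.1]
        rw [ih.1, mul_zero, sub_zero] at hw
        refine ⟨by ring, ?_⟩
        have h1 := hT h0
        have h2 := mul_nonneg (sq_nonneg (φ T)) ih.2
        have e2 : (φ T * φ (j * T) + φ' T * 0) * (φ T * φ' (j * T) + φ' T * ψ' (j * T)) =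
            φ T ^ 2 * (φ (j * T) * φ' (j * T)) + φ T * φ' T := by
          linear_combination (φ T * φ' T) * hw
        rw [e2]
        exact add_nonneg h2 h1
    exact (key n).2
  · have h1 := (h.left_add hQT (n * T)).1
    have h2 := (h.left_add (hQn n) T).1
    rw [add_comm, h2, hn] at h1
    have h3 : φ' (n * T) * ψ T = 0 := by linear_combination h1
    rcases mul_eq_zero.mp h3 with h4 | h4
    · rw [h4, mul_zero]
    · exact absurd h4 h0

end IsFundamental

namespace IsHalfWave

variable {p ω T : ℝ} {u u' : ℝ → ℝ}

theorem strictMonoOn (h : IsHalfWave p ω T u u') : StrictMonoOn u (Set.Icc 0 (T / 2)) :=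
  strictMonoOn_of_deriv_pos (convex_Icc _ _) (IsLinearSolution.continuous h.profile).continuousOn
    fun x hx => by
      rw [interior_Icc] at hx
      rw [(h.profile.hasDerivAt x).deriv]
      exact h.deriv_pos x ⟨hx.1.le, hx.2⟩

theorem strictMonoOn_abs_rpow (hp : 0 < p) (h : IsHalfWave p ω T u u') :
    StrictMonoOn (fun x => |u x| ^ (2 * p)) (Set.Icc 0 (T / 2)) := fun x hx y hy hxy => by
  have hux : 0 ≤ u x := by
    rw [← h.zero]
    exact h.strictMonoOn.monotoneOn ⟨le_rfl, by linarith [h.pos_T]⟩ hx hx.1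
  have huxy := h.strictMonoOn hx hy hxy
  simp only [abs_of_nonneg hux, abs_of_nonneg (hux.trans huxy.le)]
  exact Real.rpow_lt_rpow hux huxy (by linarith)

/-- By energy conservation the difference of the two sides is (1+p)u'(0)² - pωu², which is
nonnegative since u'(0)² - ωu² = u'² + |u|^{2p+2}. -/
theorem mul_deriv2_le (hp : 0 < p) (h : IsHalfWave p ω T u u') (x : ℝ) :
    u x * (-((ω + (p + 1) * |u x| ^ (2 * p)) * u x)) ≤ (1 + p) * u' x ^ 2 := by
  have he := h.profile.energy hp x 0
  have h1 : |u x| ^ (2 * p + 2) = |u x| ^ (2 * p) * u x ^ 2 := by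
    rw [Real.rpow_add_of_nonneg (abs_nonneg _) (by linarith) zero_le_two, Real.rpow_two, sq_abs]
  rw [h.zero, h1] at he
  have h2 : |(0 : ℝ)| ^ (2 * p + 2) = 0 := by
    rw [abs_zero, Real.zero_rpow (by linarith)]
  rw [h2] at he
  have h3 : 0 ≤ |u x| ^ (2 * p) * u x ^ 2 := by positivity
  have h4 : 0 ≤ (1 + p) * u' 0 ^ 2 - p * (ω * u x ^ 2) := by
    nlinarith [sq_nonneg (u' 0), sq_nonneg (u' x),
      mul_nonneg hp.le (show (0 : ℝ) ≤ u' 0 ^ 2 - ω * u x ^ 2 by nlinarith [sq_nonneg (u' x)])]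
  have h5 : (1 + p) * u' x ^ 2 =
      (1 + p) * (u' 0 ^ 2 - ω * u x ^ 2 - |u x| ^ (2 * p) * u x ^ 2) := by
    linear_combination (1 + p) * he
  rw [h5]
  linarith

theorem hasDerivAt_abs_rpow (h : IsHalfWave p ω T u u') {x : ℝ} (hx : x ∈ Set.Ioo 0 T) :
    HasDerivAt (fun x => |u x| ^ (2 * p)) (2 * p * |u x| ^ (2 * p) * u' x / u x) x := by
  have hux := h.pos x hx
  have hd := (h.profile.hasDerivAt x).rpow_const (p := 2 * p) (Or.inl hux.ne')
  have hev : (fun x => |u x| ^ (2 * p)) =ᶠ[nhds x] fun x => u x ^ (2 * p) := by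
    filter_upwards [isOpen_Ioo.mem_nhds hx] with y hy
    rw [abs_of_pos (h.pos y hy)]
  refine (hd.congr_deriv ?_).congr_of_eventuallyEq hev
  rw [abs_of_pos hux, Real.rpow_sub_one hux.ne']
  ring

/-- Q increases on the half period. If it stays nonpositive, convexity gives the first alternative.
Otherwise set m = φψ and I = φ'ψ' + Qm, so that I' = Q'm and m'' = 2I - 4Qm. Beyond the turning
point, 4(Q/Q')I + m' cannot decrease while I ≥ 0, and this prevents I from reaching zero before T/2
and becoming negative. -/
theorem half_alternative (hp : 0 < p) (h : IsHalfWave p ω T u u') {C E : ℝ} (hC : 0 < C)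
    (hE : E < 0) {φ φ' ψ ψ' : ℝ → ℝ}
    (hF : IsFundamental (fun x => E + C * |u x| ^ (2 * p)) φ φ' ψ ψ') :
    (0 < ψ (T / 2) ∧ 0 < ψ' (T / 2)) ∨
      (0 < E + C * |u (T / 2)| ^ (2 * p) ∧ 0 ≤ φ' (T / 2) * ψ' (T / 2) +
        (E + C * |u (T / 2)| ^ (2 * p)) * (φ (T / 2) * ψ (T / 2))) := by
  have hT := h.pos_T
  set Q : ℝ → ℝ := fun x => E + C * |u x| ^ (2 * p) with hQdef
  have hQmono : StrictMonoOn Q (Set.Icc 0 (T / 2)) := fun x hx y hy hxy => by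
    have := h.strictMonoOn_abs_rpow hp hx hy hxy
    simp only [hQdef]
    nlinarith
  have hQ0 : Q 0 = E := by
    simp [hQdef, h.zero, Real.zero_rpow (show 2 * p ≠ 0 by positivity)]
  have hucont : Continuous u := IsLinearSolution.continuous h.profile
  have hQc : Continuous Q := by
    have : Continuous fun x => |u x| ^ (2 * p) :=
      hucont.abs.rpow_const fun _ => Or.inr (by linarith)
    fun_prop
  rcases le_or_gt (Q (T / 2)) 0 with hQh | hQh
  · left
    have := hF.pos_of_neg (half_pos hT) fun x hx =>
      (hQmono ⟨hx.1, hx.2.le⟩ ⟨by linarith, le_rfl⟩ hx.2).trans_le hQh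
    exact this.2.2
  right
  refine ⟨hQh, ?_⟩
  obtain ⟨x₀, hx₀, hQx₀⟩ := intermediate_value_Ioo (by linarith : (0 : ℝ) ≤ T / 2)
    hQc.continuousOn (show (0 : ℝ) ∈ Set.Ioo (Q 0) (Q (T / 2)) from ⟨by rw [hQ0]; exact hE, hQh⟩)
  obtain ⟨p1, p2, p3, p4⟩ := hF.pos_of_neg hx₀.1 fun x hx => by
    rw [← hQx₀]
    exact hQmono ⟨hx.1, by linarith [hx.2, hx₀.2]⟩ ⟨hx₀.1.le, hx₀.2.le⟩ hx.2
  set I : ℝ → ℝ := fun x => φ' x * ψ' x + Q x * (φ x * ψ x) with hI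
  set m' : ℝ → ℝ := fun x => φ' x * ψ x + φ x * ψ' x with hm'
  have hφc := hF.left.continuous
  have hφc' := hF.left.continuous'
  have hψc := hF.right.continuous
  have hψc' := hF.right.continuous'
  have hIc : Continuous I := by fun_prop
  by_contra hneg
  have hneg' : I (T / 2) < 0 := not_le.mp hneg
  have hI0 : 0 < I x₀ := by
    simp only [hI, hQx₀, zero_mul, add_zero]
    exact mul_pos p2 p4
  obtain ⟨y, hy, hIy, hIpos⟩ := exists_first_zero hx₀.2.le hIc.continuousOn hI0 hneg'.le
  have hyh : y < T / 2 := lt_of_le_of_ne hy.2 fun hc => by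
    rw [hc] at hIy
    linarith
  -- This is Q/Q'. With this weight the terms in m cancel and the derivative of 4vI + m' is (4v' +
  -- 2)I; it remains to see v' ≥ -1/2.
  set v : ℝ → ℝ := fun x => u x * Q x / (2 * p * C * |u x| ^ (2 * p) * u' x) with hv
  have hd : ∀ x ∈ Set.Icc x₀ y, ∃ b, 0 ≤ (4 * b + 2) * I x ∧
      HasDerivAt (fun x => 4 * v x * I x + m' x) ((4 * b + 2) * I x) x := by
    intro x hx
    have hx0 : 0 < x := hx₀.1.trans_le hx.1
    have hxh : x < T / 2 := hx.2.trans_lt hyh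
    have hux : 0 < u x := h.pos x ⟨hx0, by linarith⟩
    have hux' : 0 < u' x := h.deriv_pos x ⟨hx0.le, hxh⟩
    have hw : 0 < |u x| ^ (2 * p) := Real.rpow_pos_of_pos (abs_pos.mpr hux.ne') _
    have hQx : 0 ≤ Q x := by
      rw [← hQx₀]
      exact hQmono.monotoneOn ⟨hx₀.1.le, hx₀.2.le⟩ ⟨hx0.le, hxh.le⟩ hx.1
    have hIx : 0 ≤ I x := by
      rcases eq_or_lt_of_le hx.2 with hxy | hxy
      · rw [hxy, hIy]
      · exact (hIpos x ⟨hx.1, hxy⟩).le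
    have hdw := h.hasDerivAt_abs_rpow (⟨hx0, by linarith⟩ : x ∈ Set.Ioo 0 T)
    have hdQ : HasDerivAt Q (C * (2 * p * |u x| ^ (2 * p) * u' x / u x)) x :=
      (hdw.const_mul C).const_add E
    have hdI : HasDerivAt I (C * (2 * p * |u x| ^ (2 * p) * u' x / u x) * (φ x * ψ x)) x := by
      refine (((hF.left.hasDerivAt' x).mul (hF.right.hasDerivAt' x)).add
        (hdQ.mul ((hF.left.hasDerivAt x).mul (hF.right.hasDerivAt x)))).congr_deriv ?_
      simp only [hQdef, Pi.mul_apply]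
      ring
    have hdm : HasDerivAt m' (2 * I x - 4 * (Q x * (φ x * ψ x))) x := by
      refine (((hF.left.hasDerivAt' x).mul (hF.right.hasDerivAt x)).add
        ((hF.left.hasDerivAt x).mul (hF.right.hasDerivAt' x))).congr_deriv ?_
      simp only [hQdef, hI]
      ring
    have hden : 2 * p * C * |u x| ^ (2 * p) * u' x ≠ 0 := by positivity
    set g := Q x / (C * |u x| ^ (2 * p)) with hg
    set a := -((ω + (p + 1) * |u x| ^ (2 * p)) * u x) with ha
    have hdv : HasDerivAt v (g * (1 - u x * a / u' x ^ 2) / (2 * p) + (1 - g)) x := by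
      have := ((h.profile.hasDerivAt x).mul hdQ).div
        ((hdw.const_mul (2 * p * C)).mul (h.profile.hasDerivAt' x)) hden
      refine this.congr_deriv ?_
      simp only [Pi.mul_apply, hg]
      rw [← ha]
      field_simp
      ring
    -- Here g = Q/(Q - E) is in [0, 1] because E < 0, so v' interpolates between 1 and (1 -
    -- uu''/u'²)/(2p), which is at least -1/2 by `mul_deriv2_le`.
    refine ⟨g * (1 - u x * a / u' x ^ 2) / (2 * p) + (1 - g), ?_,
      ((hdv.const_mul 4).mul hdI |>.add hdm).congr_deriv ?_⟩
    · refine mul_nonneg ?_ hIx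
      have hg0 : 0 ≤ g := by positivity
      have hg1 : g ≤ 1 := by
        rw [hg, div_le_one (by positivity)]
        simp only [hQdef]
        linarith
      have h1 : -p ≤ 1 - u x * a / u' x ^ 2 := by
        have : u x * a / u' x ^ 2 ≤ 1 + p := by
          rw [div_le_iff₀ (by positivity)]
          exact h.mul_deriv2_le hp x
        linarith
      have h2 : -(1 / 2) ≤ (1 - u x * a / u' x ^ 2) / (2 * p) := by
        rw [le_div_iff₀ (by positivity)]
        linarith
      have h3 : g * -(1 / 2) ≤ g * ((1 - u x * a / u' x ^ 2) / (2 * p)) :=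
        mul_le_mul_of_nonneg_left h2 hg0
      rw [mul_div_assoc]
      linarith
    · have hvQ : v x * (C * (2 * p * |u x| ^ (2 * p) * u' x / u x)) = Q x := by
        simp only [hv]
        field_simp
      linear_combination 4 * (φ x * ψ x) * hvQ
  have hBmono : 4 * v x₀ * I x₀ + m' x₀ ≤ 4 * v y * I y + m' y := by
    choose! b hb0 hb using hd
    have hmono : MonotoneOn (fun x => 4 * v x * I x + m' x) (Set.Icc x₀ y) :=
      monotoneOn_of_deriv_nonneg (convex_Icc _ _)
        (fun x hx => (hb x hx).continuousAt.continuousWithinAt)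
        (fun x hx => (hb x (interior_subset hx)).differentiableAt.differentiableWithinAt)
        fun x hx => by
          rw [(hb x (interior_subset hx)).deriv]
          exact hb0 x (interior_subset hx)
    exact hmono ⟨le_rfl, hy.1.le⟩ ⟨hy.1.le, le_rfl⟩ hy.1.le
  have hv0 : v x₀ = 0 := by simp [hv, hQx₀]
  rw [hv0, hIy] at hBmono
  have hm0 : 1 < m' x₀ := by
    have := hF.wronskian_eq_one x₀
    simp only [hm']
    nlinarith [mul_pos p2 p3]
  have hmy : 1 < m' y := by linarith
  have hwy := hF.wronskian_eq_one y
  have hQy : 0 ≤ Q y := by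
    rw [← hQx₀]
    exact hQmono.monotoneOn ⟨hx₀.1.le, hx₀.2.le⟩ ⟨by linarith [hx₀.1, hy.1], hyh.le⟩ hy.1.le
  -- The Wronskian gives m'² = 1 + 4mφ'ψ', and I = 0 turns this into 1 - 4Qm² ≤ 1, against m'(y) >
  -- 1.
  have hsq : m' y ^ 2 = 1 - 4 * (Q y * (φ y * ψ y) ^ 2) := by
    simp only [hm', hI] at hIy ⊢
    linear_combination (4 * (φ y * ψ y)) * hIy + (φ y * ψ' y - φ' y * ψ y + 1) * hwy
  nlinarith [mul_nonneg hQy (sq_nonneg (φ y * ψ y))]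

theorem potential_even (h : IsHalfWave p ω T u u') (C E : ℝ) (x : ℝ) :
    E + C * |u (-x)| ^ (2 * p) = E + C * |u x| ^ (2 * p) := by rw [h.odd, abs_neg]

theorem potential_periodic (h : IsHalfWave p ω T u u') (C E : ℝ) (x : ℝ) :
    E + C * |u (x + T)| ^ (2 * p) = E + C * |u x| ^ (2 * p) := by rw [h.antiperiodic, abs_neg]

/-- Below the maximum of `-q`, a Dirichlet edge of a spectral gap lies below the Neumann edge. -/
theorem mul_nonneg_of_right_eq_zero (hp : 0 < p) (h : IsHalfWave p ω T u u') {C E : ℝ}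
    (hC : 0 < C) (hE : E < 0) {φ φ' ψ ψ' : ℝ → ℝ}
    (hF : IsFundamental (fun x => E + C * |u x| ^ (2 * p)) φ φ' ψ ψ') (n : ℕ)
    (hn : ψ (n * T) = 0) : 0 ≤ φ (n * T) * φ' (n * T) := by
  refine hF.mul_nonneg_of_right_eq_zero (h.potential_periodic C E) (fun h0 => ?_) n hn
  obtain ⟨e1, e2, e3⟩ := hF.period_eq_half (h.potential_even C E) (h.potential_periodic C E)
  have hw := hF.wronskian_eq_one (T / 2)
  rw [e3] at h0
  -- Since ψ(T) = 2ψψ' at T/2, one factor vanishes there, and the surviving term of I ≥ 0 carries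
  -- the sign of φ(T)φ'(T).
  rcases h.half_alternative hp hC hE hF with ⟨h1, h2⟩ | ⟨hQ, hI⟩
  · exact absurd h0 (by positivity)
  have h0' : ψ (T / 2) = 0 ∨ ψ' (T / 2) = 0 := by
    rcases mul_eq_zero.mp h0 with h3 | h3
    · norm_num at h3
    · exact mul_eq_zero.mp h3
  rw [e1, e2]
  generalize φ (T / 2) = α at *
  generalize φ' (T / 2) = γ at *
  generalize ψ (T / 2) = β at *
  generalize ψ' (T / 2) = δ at *
  rcases h0' with rfl | rfl
  · have h1 : (α * δ + 0 * γ) * (2 * (α * γ)) = 2 * α ^ 2 * (γ * δ) := by ring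
    rw [h1]
    have : 0 ≤ γ * δ := by simpa using hI
    positivity
  · have h1 : (α * 0 + β * γ) * (2 * (α * γ)) = 2 * γ ^ 2 * (α * β) := by ring
    rw [h1]
    have : 0 ≤ α * β := by
      rw [mul_zero, zero_add] at hI
      exact nonneg_of_mul_nonneg_right hI hQ
    positivity

end IsHalfWave

/-! ### Sobolev functions and the ring problem -/

/-- A closed interval onto which the real line retracts. -/
structure IsRetractInterval (I : Set ℝ) : Prop where
  ordConnected : I.OrdConnected
  measurableSet : MeasurableSet I
  uniqueDiffOn : UniqueDiffOn ℝ I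
  retraction : ∃ π : ℝ → ℝ, Continuous π ∧ (∀ t, π t ∈ I) ∧ ∀ t ∈ I, π t = t

theorem isRetractInterval_Icc {a b : ℝ} (hab : a < b) : IsRetractInterval (Set.Icc a b) :=
  ⟨Set.ordConnected_Icc, measurableSet_Icc, uniqueDiffOn_Icc hab,
    fun t => max a (min b t), by fun_prop,
    fun t => ⟨le_max_left _ _, max_le hab.le (min_le_left _ _)⟩,
    fun t ht => by simp only [min_eq_right ht.2, max_eq_right ht.1]⟩

theorem isRetractInterval_Ici (a : ℝ) : IsRetractInterval (Set.Ici a) :=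
  ⟨Set.ordConnected_Ici, measurableSet_Ici, uniqueDiffOn_Ici a,
    fun t => max a t, by fun_prop, fun t => Set.mem_Ici.mpr (le_max_left _ _),
    fun t ht => max_eq_right ht⟩

namespace IsRetractInterval

variable {I : Set ℝ} {f g : ℝ → ℂ}

theorem continuousOn_of_primitive (hI : IsRetractInterval I)
    (hg : MemLp g 2 (volume.restrict I))
    (h : ∀ x ∈ I, ∀ y ∈ I, f y - f x = ∫ t in x..y, g t) : ContinuousOn f I := by
  intro x hx
  have hloc : LocallyIntegrable (I.indicator g) volume :=
    ((memLp_indicator_iff_restrict hI.measurableSet).mpr hg).locallyIntegrable (by norm_num)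
  have hc : Continuous fun y => f x + ∫ t in x..y, I.indicator g t :=
    continuous_const.add (intervalIntegral.continuous_primitive
      (fun a b => (hloc.integrableOn_isCompact isCompact_uIcc).intervalIntegrable) x)
  refine hc.continuousWithinAt.congr (fun y hy => ?_) (by simp)
  rw [intervalIntegral.integral_congr (g := g) fun t ht =>
    Set.indicator_of_mem (hI.ordConnected.uIcc_subset hx hy ht) g, ← h x hx y hy]
  ring

theorem hasDerivWithinAt_of_primitive (hI : IsRetractInterval I) (hg : ContinuousOn g I)
    (h : ∀ x ∈ I, ∀ y ∈ I, f y - f x = ∫ t in x..y, g t) :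
    ∀ x ∈ I, HasDerivWithinAt f (g x) I x := by
  intro x hx
  -- Composition with the retraction extends g continuously to the line, so the two-sided
  -- fundamental theorem of calculus applies even at end points.
  obtain ⟨π, hπ, hmem, hid⟩ := hI.retraction
  have hc : Continuous fun t => g (π t) := hg.comp_continuous hπ hmem
  have hd : HasDerivAt (fun y => f x + ∫ t in x..y, g (π t)) (g (π x)) x :=
    (intervalIntegral.integral_hasDerivAt_right (hc.intervalIntegrable _ _)
      (hc.stronglyMeasurableAtFilter _ _) hc.continuousAt).const_add _
  rw [hid x hx] at hd
  refine hd.hasDerivWithinAt.congr (fun y hy => ?_) (by simp)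
  rw [intervalIntegral.integral_congr (g := g) fun t ht => by
    simp only [hid t (hI.ordConnected.uIcc_subset hx hy ht)], ← h x hx y hy]
  ring

end IsRetractInterval

namespace IsH2On

variable {I : Set ℝ} {f f₁ f₂ g₁ g₂ : ℝ → ℂ}

theorem continuousOn (h : IsH2On I f f₁ f₂) (hI : IsRetractInterval I) : ContinuousOn f I :=
  hI.continuousOn_of_primitive h.memLp_one h.primitive_zero

theorem hasDerivWithinAt (h : IsH2On I f f₁ f₂) (hI : IsRetractInterval I) :
    ∀ x ∈ I, HasDerivWithinAt f (f₁ x) I x :=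
  hI.hasDerivWithinAt_of_primitive (hI.continuousOn_of_primitive h.memLp_two h.primitive_one)
    h.primitive_zero

theorem hasDerivWithinAt' (h : IsH2On I f f₁ f₂) (hI : IsRetractInterval I) {c : ℝ → ℂ}
    (hc : Continuous c) (hode : ∀ᵐ x ∂(volume.restrict I), f₂ x = c x * f x) :
    ∀ x ∈ I, HasDerivWithinAt f₁ (c x * f x) I x := by
  refine hI.hasDerivWithinAt_of_primitive (hc.continuousOn.mul (h.continuousOn hI))
    fun x hx y hy => ?_
  rw [h.primitive_one x hx y hy]
  refine intervalIntegral.integral_congr_ae ?_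
  filter_upwards [(ae_restrict_iff' hI.measurableSet).mp hode] with t ht hxy
  exact ht (hI.ordConnected.uIcc_subset hx hy (Set.uIoc_subset_uIcc hxy))

theorem deriv_unique (h : IsH2On I f f₁ f₂) (h' : IsH2On I f g₁ g₂) (hI : IsRetractInterval I) :
    ∀ x ∈ I, f₁ x = g₁ x := fun x hx =>
  (hI.uniqueDiffOn x hx).eq_deriv _ (h.hasDerivWithinAt hI x hx) (h'.hasDerivWithinAt hI x hx)

/-- A classical solution is in `H²` as soon as the three functions are square integrable. -/
theorem of_hasDerivAt {F F₁ F₂ : ℝ → ℂ} (hI : IsRetractInterval I) (hF : ∀ x, HasDerivAt F (F₁ x) x)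
    (hF₁ : ∀ x, HasDerivAt F₁ (F₂ x) x) (hF₂ : Continuous F₂)
    (m : MemLp F 2 (volume.restrict I)) (m₁ : MemLp F₁ 2 (volume.restrict I))
    (m₂ : MemLp F₂ 2 (volume.restrict I)) (hf : ∀ x ∈ I, f x = F x) : IsH2On I f F₁ F₂ := by
  have hF₁c : Continuous F₁ := continuous_iff_continuousAt.mpr fun x => (hF₁ x).continuousAt
  refine ⟨m.ae_eq ?_, m₁, m₂, fun x hx y hy => ?_, fun x hx y hy => ?_⟩
  · filter_upwards [ae_restrict_mem hI.measurableSet] with x hx using (hf x hx).symm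
  · rw [hf x hx, hf y hy, intervalIntegral.integral_eq_sub_of_hasDerivAt (fun t _ => hF t)
      (hF₁c.intervalIntegrable _ _)]
  · rw [intervalIntegral.integral_eq_sub_of_hasDerivAt (fun t _ => hF₁ t)
      (hF₂.intervalIntegrable _ _)]

end IsH2On

theorem Continuous.memLp_restrict_Icc {F : ℝ → ℂ} (hF : Continuous F) (a b : ℝ) :
    MemLp F 2 (volume.restrict (Set.Icc a b)) := by
  obtain ⟨C, hC⟩ := isCompact_Icc.exists_bound_of_continuousOn hF.continuousOn
    (s := Set.Icc a b)
  refine MemLp.of_bound hF.aestronglyMeasurable C ?_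
  filter_upwards [ae_restrict_mem measurableSet_Icc] with x hx using hC x hx

theorem constant_of_hasDerivWithinAt_Icc {f : ℝ → ℂ} {a b : ℝ} (hab : a < b)
    (hf : ∀ x ∈ Set.Icc a b, HasDerivWithinAt f 0 (Set.Icc a b) x) :
    ∀ x ∈ Set.Icc a b, ∀ y ∈ Set.Icc a b, f x = f y := by
  have h := constant_of_derivWithin_zero (fun x hx => (hf x hx).differentiableWithinAt)
    fun x hx => (hf x (Set.Ico_subset_Icc_self hx)).derivWithin
      (uniqueDiffOn_Icc hab x (Set.Ico_subset_Icc_self hx))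
  exact fun x hx y hy => (h x hx).trans (h y hy).symm

/-- A complex solution on `[-L, L]` is a combination of the two fundamental solutions. -/
theorem IsFundamental.exists_combination {Q φ φ' ψ ψ' : ℝ → ℝ} (hF : IsFundamental Q φ φ' ψ ψ')
    {L : ℝ} (hL : 0 < L) {U U₁ : ℝ → ℂ}
    (hU : ∀ x ∈ Set.Icc (-L) L, HasDerivWithinAt U (U₁ x) (Set.Icc (-L) L) x)
    (hU₁ : ∀ x ∈ Set.Icc (-L) L, HasDerivWithinAt U₁ (-(Q x : ℂ) * U x) (Set.Icc (-L) L) x) :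
    ∃ z₀ z₁ : ℂ, ∀ x ∈ Set.Icc (-L) L,
      U x = z₀ * φ x + z₁ * ψ x ∧ U₁ x = z₀ * φ' x + z₁ * ψ' x := by
  have hw : ∀ {f f' : ℝ → ℝ}, IsLinearSolution Q f f' → ∀ x ∈ Set.Icc (-L) L,
      HasDerivWithinAt (fun x => U x * f' x - U₁ x * f x) 0 (Set.Icc (-L) L) x := by
    intro f f' hf x hx
    refine (((hU x hx).mul (hf.hasDerivAt' x).ofReal_comp.hasDerivWithinAt).sub
      ((hU₁ x hx).mul (hf.hasDerivAt x).ofReal_comp.hasDerivWithinAt)).congr_deriv ?_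
    push_cast
    ring
  have h0 : (0 : ℝ) ∈ Set.Icc (-L) L := ⟨by linarith, hL.le⟩
  refine ⟨U 0, U₁ 0, fun x hx => ?_⟩
  have h1 := constant_of_hasDerivWithinAt_Icc (by linarith) (hw hF.left) x hx 0 h0
  have h2 := constant_of_hasDerivWithinAt_Icc (by linarith) (hw hF.right) x hx 0 h0
  simp only [hF.left_zero, hF.left_zero', hF.right_zero, hF.right_zero', Complex.ofReal_zero,
    Complex.ofReal_one] at h1 h2
  have h3 : (φ x : ℂ) * ψ' x - φ' x * ψ x = 1 := by exact_mod_cast hF.wronskian_eq_one x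
  constructor
  · linear_combination (-U x) * h3 - (ψ x : ℂ) * h1 + (φ x : ℂ) * h2
  · linear_combination (-U₁ x) * h3 - (ψ' x : ℂ) * h1 + (φ' x : ℂ) * h2

theorem ae_restrict_Icc_of_Ioo {a b : ℝ} {P : ℝ → Prop}
    (h : ∀ᵐ x ∂(volume.restrict (Set.Ioo a b)), P x) :
    ∀ᵐ x ∂(volume.restrict (Set.Icc a b)), P x := by
  rwa [Measure.restrict_congr_set Ioo_ae_eq_Icc] at h

theorem ae_restrict_Ici_of_Ioi {a : ℝ} {P : ℝ → Prop}
    (h : ∀ᵐ x ∂(volume.restrict (Set.Ioi a)), P x) :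
    ∀ᵐ x ∂(volume.restrict (Set.Ici a)), P x := by
  rwa [Measure.restrict_congr_set Ioi_ae_eq_Ici] at h

/-- Below the continuous spectrum, the non-periodic eigenfunctions of the ring problem are the
multiples of the even fundamental solution, provided that it satisfies the boundary condition. -/
theorem nonperiodic_ringEigenfunction_iff {Q q φ φ' ψ ψ' : ℝ → ℝ} {L ω mu : ℝ} (hL : 0 < L)
    (hq : Continuous q) (hQ : ∀ x, Q x = ω + mu + q x) (heven : ∀ x, Q (-x) = Q x)
    (hF : IsFundamental Q φ φ' ψ ψ') (hE : mu + ω < 0)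
    (hgap : ψ L = 0 → 0 ≤ φ L * φ' L) (U : ℝ → ℂ) :
    (IsRingEigenfunction L ω q mu U ∧ ¬ MemH2Per L U) ↔
      2 * φ' L + Real.sqrt |ω + mu| * φ L = 0 ∧
        ∃ z : ℂ, z ≠ 0 ∧ ∀ x ∈ Set.Icc (-L) L, U x = z * φ x := by
  have hI := isRetractInterval_Icc (show -L < L by linarith)
  have hLmem : L ∈ Set.Icc (-L) L := ⟨by linarith, le_rfl⟩
  have hLmem' : -L ∈ Set.Icc (-L) L := ⟨le_rfl, by linarith⟩
  have hk : 0 < Real.sqrt |ω + mu| := Real.sqrt_pos.mpr (abs_pos.mpr (by linarith))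
  have hw := hF.wronskian_eq_one L
  have hφ := hF.left_neg heven L
  have hψ := hF.right_neg heven L
  constructor
  · rintro ⟨⟨-, U₁, U₂, hH, hode, hper, hbc⟩, hnp⟩
    have hode' : ∀ᵐ x ∂(volume.restrict (Set.Icc (-L) L)), U₂ x = -(Q x : ℂ) * U x := by
      filter_upwards [ae_restrict_Icc_of_Ioo hode] with x hx
      rw [hQ]
      push_cast
      linear_combination -hx
    have hQc : Continuous fun x => -(Q x : ℂ) := by
      have : Continuous Q := by
        rw [funext hQ]
        fun_prop
      fun_prop
    obtain ⟨z₀, z₁, hz⟩ := hF.exists_combination hL (hH.hasDerivWithinAt hI)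
      (hH.hasDerivWithinAt' hI hQc hode')
    obtain ⟨e1, e2⟩ := hz L hLmem
    obtain ⟨e3, e4⟩ := hz (-L) hLmem'
    rw [hφ.1, hψ.1] at e3
    rw [hφ.2, hψ.2] at e4
    push_cast at e3 e4
    have h1 : z₁ * ψ L = 0 := by linear_combination (1 / 2 : ℂ) * (hper - e1 + e3)
    have h2 : z₀ * ((2 * φ' L + Real.sqrt |ω + mu| * φ L : ℝ) : ℂ) = 0 := by
      push_cast
      linear_combination hbc - e2 + e4 + (Real.sqrt |ω + mu| : ℂ) * (-e1) +
        (-(Real.sqrt |ω + mu| : ℂ)) * h1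
    have hz₀ : z₀ ≠ 0 := by
      rintro rfl
      exact hnp ⟨U₁, U₂, hH, hper, by rw [e2, e4]; ring⟩
    have h3 : 2 * φ' L + Real.sqrt |ω + mu| * φ L = 0 := by
      rcases mul_eq_zero.mp h2 with h | h
      · exact absurd h hz₀
      · exact_mod_cast h
    -- If ψ(L) = 0, the Wronskian gives φ(L) ≠ 0, and the boundary condition makes φφ' negative at
    -- L, contrary to the gap inequality.
    have hψL : ψ L ≠ 0 := fun h => by
      have h4 := hgap h
      rw [h, mul_zero, sub_zero] at hw
      have h5 : φ L ≠ 0 := fun h => by rw [h] at hw; norm_num at hw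
      have h6 : 0 < φ L ^ 2 := by positivity
      have h7 : 2 * (φ L * φ' L) + Real.sqrt |ω + mu| * φ L ^ 2 = 0 := by
        linear_combination φ L * h3
      linarith [mul_pos hk h6]
    have hz₁ : z₁ = 0 := by
      rcases mul_eq_zero.mp h1 with h | h
      · exact h
      · exact absurd (by exact_mod_cast h) hψL
    refine ⟨h3, z₀, hz₀, fun x hx => ?_⟩
    rw [(hz x hx).1, hz₁]
    ring
  · rintro ⟨h3, z, hz, hU⟩
    have hQc : Continuous Q := by
      rw [funext hQ]
      fun_prop
    have hφc := hF.left.continuous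
    have hφc' := hF.left.continuous'
    have hH : IsH2On (Set.Icc (-L) L) U (fun x => z * φ' x) (fun x => z * ((-(Q x * φ x) : ℝ) : ℂ)) :=
      IsH2On.of_hasDerivAt (F := fun x => z * φ x) hI
        (fun x => (hF.left.hasDerivAt x).ofReal_comp.const_mul z)
        (fun x => (hF.left.hasDerivAt' x).ofReal_comp.const_mul z) (by fun_prop)
        (Continuous.memLp_restrict_Icc (by fun_prop) _ _)
        (Continuous.memLp_restrict_Icc (by fun_prop) _ _)
        (Continuous.memLp_restrict_Icc (by fun_prop) _ _) hU
    have hφL : φ' L ≠ 0 := fun h => by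
      rw [h, mul_zero, zero_add] at h3
      rcases mul_eq_zero.mp h3 with h4 | h4
      · exact hk.ne' h4
      · rw [h, h4] at hw
        norm_num at hw
    refine ⟨⟨⟨0, ⟨by linarith, hL.le⟩, ?_⟩, _, _, hH, ?_, ?_, ?_⟩, ?_⟩
    · rw [hU 0 ⟨by linarith, hL.le⟩, hF.left_zero]
      simpa using hz
    · filter_upwards [ae_restrict_mem measurableSet_Ioo] with x hx
      rw [hU x (Set.Ioo_subset_Icc_self hx), hQ]
      push_cast
      ring
    · rw [hU L hLmem, hU (-L) hLmem', hφ.1]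
    · rw [hU L hLmem, hφ.2]
      have h4 : ((2 * φ' L + Real.sqrt |ω + mu| * φ L : ℝ) : ℂ) = 0 := by rw [h3]; simp
      push_cast at h4 ⊢
      linear_combination z * h4
    · rintro ⟨W₁, W₂, hW, -, hW₁⟩
      have h4 := hH.deriv_unique hW hI L hLmem
      have h5 := hH.deriv_unique hW hI (-L) hLmem'
      rw [← h4, ← h5, hφ.2] at hW₁
      push_cast at hW₁
      have h6 : z * φ' L = 0 := by linear_combination (1 / 2 : ℂ) * hW₁
      rcases mul_eq_zero.mp h6 with h7 | h7
      · exact hz h7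
      · exact hφL (by exact_mod_cast h7)

/-! ### The half-line tail and reality of the eigenvalue -/

theorem constant_of_hasDerivWithinAt_Ici {f : ℝ → ℂ} {a : ℝ}
    (hf : ∀ x ∈ Set.Ici a, HasDerivWithinAt f 0 (Set.Ici a) x) : ∀ x ∈ Set.Ici a, f x = f a := by
  intro x hx
  rcases eq_or_lt_of_le (Set.mem_Ici.mp hx) with h | h
  · rw [h]
  · exact constant_of_hasDerivWithinAt_Icc h
      (fun y hy => (hf y hy.1).mono Set.Icc_subset_Ici_self) x ⟨h.le, le_rfl⟩ a ⟨le_rfl, h.le⟩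

theorem eq_zero_of_memLp_Ici_of_norm_le {f : ℝ → ℂ} {c : ℂ} {a : ℝ}
    (hf : MemLp f 2 (volume.restrict (Set.Ici a))) (h : ∀ x ∈ Set.Ici a, ‖c‖ ≤ ‖f x‖) : c = 0 := by
  have hc : MemLp (fun _ : ℝ => c) 2 (volume.restrict (Set.Ici a)) :=
    hf.mono aestronglyMeasurable_const <| by
      filter_upwards [ae_restrict_mem measurableSet_Ici] with x hx using h x hx
  rcases (memLp_const_iff (by norm_num) (by norm_num)).mp hc with h0 | h0
  · exact h0
  · simp at h0

/-- A nonzero square integrable solution of `-V'' = z V` on a half-line decays exponentially. -/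
theorem IsH2On.exists_decay_rate {L : ℝ} {z : ℂ} {V V₁ V₂ : ℝ → ℂ}
    (h : IsH2On (Set.Ici L) V V₁ V₂)
    (hode : ∀ᵐ x ∂(volume.restrict (Set.Ici L)), V₂ x = -z * V x)
    (hne : ∃ x ∈ Set.Ici L, V x ≠ 0) :
    ∃ κ : ℂ, κ ^ 2 = -z ∧ 0 < κ.re ∧ V L ≠ 0 ∧ V₁ L = -κ * V L ∧
      ∀ x ∈ Set.Ici L, V x = V L * Complex.exp (-κ * ((x - L : ℝ) : ℂ)) := by
  have hI := isRetractInterval_Ici L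
  have hV := h.hasDerivWithinAt hI
  have hV₁ := h.hasDerivWithinAt' hI (c := fun _ => -z) continuous_const hode
  obtain ⟨κ, hκ, hre⟩ : ∃ κ : ℂ, κ ^ 2 = -z ∧ 0 ≤ κ.re := by
    obtain ⟨κ, hκ⟩ := IsAlgClosed.exists_pow_nat_eq (-z) (n := 2) (by norm_num)
    rcases le_total 0 κ.re with h0 | h0
    · exact ⟨κ, hκ, h0⟩
    · exact ⟨-κ, by rw [neg_sq, hκ], by simpa using h0⟩
  have hexp : ∀ (c : ℂ) (x : ℝ), HasDerivWithinAt
      (fun x : ℝ => Complex.exp (c * ((x - L : ℝ) : ℂ)))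
      (Complex.exp (c * ((x - L : ℝ) : ℂ)) * c) (Set.Ici L) x := fun c x => by
    have h1 : HasDerivAt (fun x : ℝ => ((x - L : ℝ) : ℂ)) 1 x := by
      simpa using ((hasDerivAt_id x).sub_const L).ofReal_comp
    simpa using (h1.const_mul c).cexp.hasDerivWithinAt
  have hL : L ∈ Set.Ici L := Set.mem_Ici.mpr le_rfl
  have hinv : ∀ (c : ℂ) (x : ℝ), Complex.exp (-c * ((x - L : ℝ) : ℂ)) *
      Complex.exp (c * ((x - L : ℝ) : ℂ)) = 1 := fun c x => by
    rw [← Complex.exp_add]; simp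
  have hG : ∀ x ∈ Set.Ici L, V₁ x + κ * V x =
      (V₁ L + κ * V L) * Complex.exp (κ * ((x - L : ℝ) : ℂ)) := fun x hx => by
    have hc := constant_of_hasDerivWithinAt_Ici (a := L)
      (f := fun x => (V₁ x + κ * V x) * Complex.exp (-κ * ((x - L : ℝ) : ℂ))) (fun y hy => by
        refine (((hV₁ y hy).add ((hV y hy).const_mul κ)).mul (hexp (-κ) y)).congr_deriv ?_
        simp only [Pi.add_apply]
        linear_combination (-Complex.exp (-κ * ((y - L : ℝ) : ℂ)) * V y) * hκ) x hx
    simp only [sub_self, Complex.ofReal_zero, mul_zero, Complex.exp_zero, mul_one] at hc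
    rw [← hc]
    linear_combination (-(V₁ x + κ * V x)) * hinv κ x
  -- V' + κV is a multiple of exp(κ(x - L)), whose modulus is at least one as Re κ ≥ 0; square
  -- integrability kills the multiple.
  have hG0 : V₁ L + κ * V L = 0 := by
    refine eq_zero_of_memLp_Ici_of_norm_le (h.memLp_one.add (h.memLp_zero.const_mul κ))
      fun x hx => ?_
    rw [Pi.add_apply, hG x hx, norm_mul, Complex.norm_exp]
    refine le_mul_of_one_le_right (norm_nonneg _) (Real.one_le_exp ?_)
    rw [Complex.re_mul_ofReal]
    exact mul_nonneg hre (sub_nonneg.mpr hx)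
  have hVx : ∀ x ∈ Set.Ici L, V x = V L * Complex.exp (-κ * ((x - L : ℝ) : ℂ)) := fun x hx => by
    have hc := constant_of_hasDerivWithinAt_Ici (a := L)
      (f := fun x => V x * Complex.exp (κ * ((x - L : ℝ) : ℂ))) (fun y hy => by
        refine ((hV y hy).mul (hexp κ y)).congr_deriv ?_
        have := hG y hy
        rw [hG0, zero_mul] at this
        linear_combination Complex.exp (κ * ((y - L : ℝ) : ℂ)) * this) x hx
    simp only [sub_self, Complex.ofReal_zero, mul_zero, Complex.exp_zero, mul_one] at hc
    rw [← hc]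
    linear_combination (-V x) * hinv κ x
  have hVL : V L ≠ 0 := fun h0 => by
    obtain ⟨x, hx, hx0⟩ := hne
    exact hx0 (by rw [hVx x hx, h0, zero_mul])
  refine ⟨κ, hκ, lt_of_le_of_ne hre fun h0 => hVL ?_, hVL, by linear_combination hG0, hVx⟩
  refine eq_zero_of_memLp_Ici_of_norm_le h.memLp_zero fun x hx => ?_
  rw [hVx x hx, norm_mul, Complex.norm_exp, Complex.re_mul_ofReal, Complex.neg_re, ← h0]
  simp

/-- The decay rate of an eigenfunction on the tadpole graph is real. -/
theorem decay_rate_im_eq_zero {L : ℝ} (hL : 0 < L) {κ : ℂ} {q : ℝ → ℝ} {U U₁ : ℝ → ℂ}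
    (hre : 0 < κ.re) (hU0 : U L ≠ 0)
    (hU : ∀ x ∈ Set.Icc (-L) L, HasDerivWithinAt U (U₁ x) (Set.Icc (-L) L) x)
    (hU₁ : ∀ x ∈ Set.Icc (-L) L,
      HasDerivWithinAt U₁ ((κ ^ 2 - q x) * U x) (Set.Icc (-L) L) x)
    (hper : U L = U (-L)) (hbc : U₁ L - U₁ (-L) = -κ * U L) : κ.im = 0 := by
  by_contra him
  -- The flux Im(Ū U') divided by Im κ has derivative 2 Re κ |U|² ≥ 0, q being real, whereas the
  -- boundary condition makes its increment -|U(L)|² < 0.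
  set S : ℝ → ℝ := fun x => ((U x).re * (U₁ x).im - (U x).im * (U₁ x).re) / κ.im with hS
  have hd : ∀ x ∈ Set.Icc (-L) L, HasDerivWithinAt S
      (2 * κ.re * ((U x).re ^ 2 + (U x).im ^ 2)) (Set.Icc (-L) L) x := fun x hx => by
    have h1 := Complex.reCLM.hasFDerivAt.comp_hasDerivWithinAt x (hU x hx)
    have h2 := Complex.imCLM.hasFDerivAt.comp_hasDerivWithinAt x (hU x hx)
    have h3 := Complex.reCLM.hasFDerivAt.comp_hasDerivWithinAt x (hU₁ x hx)
    have h4 := Complex.imCLM.hasFDerivAt.comp_hasDerivWithinAt x (hU₁ x hx)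
    refine (((h1.mul h4).sub (h2.mul h3)).div_const κ.im).congr_deriv ?_
    simp only [Function.comp_apply, Complex.reCLM_apply, Complex.imCLM_apply, Complex.mul_re,
      Complex.mul_im, Complex.sub_re, Complex.sub_im, pow_two, Complex.ofReal_re,
      Complex.ofReal_im]
    field_simp
    ring
  have hmono : MonotoneOn S (Set.Icc (-L) L) := by
    refine monotoneOn_of_deriv_nonneg (convex_Icc _ _)
      (fun x hx => (hd x hx).continuousWithinAt)
      (fun x hx => (hd x (interior_subset hx)).differentiableWithinAt.mono interior_subset)
      fun x hx => ?_
    rw [((hd x (interior_subset hx)).hasDerivAt (mem_interior_iff_mem_nhds.mp hx)).deriv]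
    positivity
  have h := hmono (⟨le_rfl, by linarith⟩ : -L ∈ Set.Icc (-L) L) ⟨by linarith, le_rfl⟩ (by linarith)
  have e1 := congrArg Complex.re hbc
  have e2 := congrArg Complex.im hbc
  simp only [Complex.sub_re, Complex.sub_im, Complex.mul_re, Complex.mul_im, Complex.neg_re,
    Complex.neg_im] at e1 e2
  have hdiff : S L - S (-L) = -((U L).re ^ 2 + (U L).im ^ 2) := by
    simp only [hS, ← hper]
    field_simp
    linear_combination (U L).re * e2 - (U L).im * e1
  have hpos : 0 < (U L).re ^ 2 + (U L).im ^ 2 := by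
    have := Complex.normSq_pos.mpr hU0
    rw [Complex.normSq_apply] at this
    nlinarith
  linarith

theorem memLp_exp_decay {k : ℝ} (hk : 0 < k) (L : ℝ) (c : ℂ) :
    MemLp (fun x : ℝ => c * (Real.exp (-(k * (x - L))) : ℝ)) 2 (volume.restrict (Set.Ici L)) := by
  have hr : MemLp (fun x : ℝ => Real.exp (-(k * (x - L)))) 2 (volume.restrict (Set.Ici L)) := by
    rw [memLp_two_iff_integrable_sq (by fun_prop)]
    have h1 : IntegrableOn (fun x : ℝ => Real.exp (2 * (k * L)) * Real.exp ((-2 * k) * x))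
        (Set.Ici L) := by
      rw [integrableOn_Ici_iff_integrableOn_Ioi]
      exact (integrableOn_exp_mul_Ioi (by linarith) L).const_mul _
    refine h1.congr (Filter.Eventually.of_forall fun x => ?_)
    simp only
    rw [← Real.exp_add, ← Real.exp_nat_mul]
    congr 1
    push_cast
    ring
  exact hr.ofReal.const_mul c

theorem tadpoleEigenfunction_iff {L ω : ℝ} (hL : 0 < L) {q : ℝ → ℝ} (hq : Continuous q)
    (lam : ℂ) (U V : ℝ → ℂ) :
    (IsTadpoleEigenfunction L ω q lam U V ∧ ∃ x ∈ Set.Ici L, V x ≠ 0) ↔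
      ∃ mu : ℝ, lam = (mu : ℂ) ∧ mu + ω < 0 ∧ IsRingEigenfunction L ω q mu U ∧ ¬ MemH2Per L U ∧
        ∀ x ∈ Set.Ici L,
          V x = U L * (Real.exp (-(Real.sqrt |ω + mu| * (x - L))) : ℝ) := by
  have hI := isRetractInterval_Icc (show -L < L by linarith)
  have hLmem : L ∈ Set.Icc (-L) L := ⟨by linarith, le_rfl⟩
  have hLmem' : -L ∈ Set.Icc (-L) L := ⟨le_rfl, by linarith⟩
  constructor
  · rintro ⟨⟨-, U₁, U₂, V₁, V₂, hdom, hodeU, hodeV⟩, hne⟩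
    obtain ⟨κ, hκ, hre, hVL, hV₁, hV⟩ := hdom.tail.exists_decay_rate (z := ω + lam) (by
      filter_upwards [ae_restrict_Ici_of_Ioi hodeV] with x hx
      linear_combination -hx) hne
    have hUL : U L ≠ 0 := by rw [hdom.continuity_tail]; exact hVL
    have hbc : U₁ L - U₁ (-L) = -κ * U L := by
      rw [hdom.kirchhoff, hV₁, hdom.continuity_tail]
    have him : κ.im = 0 := decay_rate_im_eq_zero hL hre hUL (hdom.ring.hasDerivWithinAt hI)
      (hdom.ring.hasDerivWithinAt' hI (c := fun x => κ ^ 2 - q x) (by fun_prop) (by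
        filter_upwards [ae_restrict_Icc_of_Ioo hodeU] with x hx
        rw [hκ]
        linear_combination -hx)) hdom.continuity_ring hbc
    obtain ⟨k, rfl⟩ : ∃ k : ℝ, κ = k := ⟨κ.re, Complex.ext (by simp) (by simp [him])⟩
    rw [Complex.ofReal_re] at hre
    have hmu : lam = ((-k ^ 2 - ω : ℝ) : ℂ) := by
      push_cast
      linear_combination hκ
    have hsq : Real.sqrt |ω + (-k ^ 2 - ω)| = k := by
      rw [show ω + (-k ^ 2 - ω) = -k ^ 2 by ring, abs_neg, abs_of_nonneg (sq_nonneg k),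
        Real.sqrt_sq hre.le]
    refine ⟨-k ^ 2 - ω, hmu, by nlinarith, ⟨⟨L, hLmem, hUL⟩, U₁, U₂, hdom.ring, ?_,
      hdom.continuity_ring, ?_⟩, ?_, fun x hx => ?_⟩
    · rw [← hmu]; exact hodeU
    · rw [hsq, hbc]; ring
    · rintro ⟨W₁, W₂, hW, -, hW₁⟩
      rw [hdom.ring.deriv_unique hW hI L hLmem, hdom.ring.deriv_unique hW hI (-L) hLmem', hW₁,
        sub_self] at hbc
      have h0 : (k : ℂ) * U L = 0 := by linear_combination hbc
      rcases mul_eq_zero.mp h0 with h1 | h1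
      · exact hre.ne' (by exact_mod_cast h1)
      · exact hUL h1
    · rw [hsq, hV x hx, hdom.continuity_tail]
      push_cast
      congr 2
      ring
  · rintro ⟨mu, rfl, hE, ⟨hne, U₁, U₂, hH, hode, hper, hbc⟩, hnp, hV⟩
    set k := Real.sqrt |ω + mu| with hkdef
    have hk : 0 < k := Real.sqrt_pos.mpr (abs_pos.mpr (by linarith))
    have hk2 : k ^ 2 = -(ω + mu) := by
      rw [hkdef, Real.sq_sqrt (abs_nonneg _), abs_of_neg (by linarith)]
    have hVL : V L = U L := by rw [hV L Set.self_mem_Ici]; simp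
    have hUL : U L ≠ 0 := fun h0 => hnp ⟨U₁, U₂, hH, hper, by
      rw [h0, zero_mul, neg_zero] at hbc
      exact sub_eq_zero.mp hbc⟩
    have hd : ∀ (c : ℂ) (x : ℝ), HasDerivAt
        (fun x : ℝ => c * (Real.exp (-(k * (x - L))) : ℝ))
        ((-k * c) * (Real.exp (-(k * (x - L))) : ℝ)) x := fun c x => by
      have h1 : HasDerivAt (fun x : ℝ => Real.exp (-(k * (x - L))))
          (Real.exp (-(k * (x - L))) * -k) x := by
        simpa using ((((hasDerivAt_id x).sub_const L).const_mul k).neg).exp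
      refine (h1.ofReal_comp.const_mul c).congr_deriv ?_
      push_cast
      ring
    have hHV := IsH2On.of_hasDerivAt (isRetractInterval_Ici L) (hd (U L)) (hd (-k * U L))
      (by fun_prop) (memLp_exp_decay hk L _) (memLp_exp_decay hk L _) (memLp_exp_decay hk L _) hV
    refine ⟨⟨Or.inr ⟨L, Set.self_mem_Ici, by rwa [hVL]⟩, U₁, U₂, _, _,
      ⟨hH, hHV, hper, hVL.symm, ?_⟩, hode, ?_⟩, L, Set.self_mem_Ici, by rwa [hVL]⟩
    · rw [hbc]
      simp only [sub_self, mul_zero, neg_zero, Real.exp_zero, Complex.ofReal_one, mul_one]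
      ring
    · filter_upwards [ae_restrict_mem measurableSet_Ioi] with x hx
      rw [hV x (Set.Ioi_subset_Ici_self hx)]
      have h2 : (k : ℂ) ^ 2 = -(ω + mu) := by exact_mod_cast hk2
      linear_combination (-U L * (Real.exp (-(k * (x - L))) : ℝ)) * h2

/-! ### Comparison of Prüfer angles and counting of crossings -/

theorem Real.sinc_mul_self (x : ℝ) : Real.sinc x * x = Real.sin x := by
  rcases eq_or_ne x 0 with rfl | hx
  · simp
  · rw [Real.sinc_of_ne_zero hx, div_mul_cancel₀ _ hx]

theorem Real.sin_sq_sub_sin_sq_eq_sinc (a b : ℝ) :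
    Real.sin b ^ 2 - Real.sin a ^ 2 = Real.sin (a + b) * Real.sinc (b - a) * (b - a) := by
  rw [mul_assoc, Real.sinc_mul_self, Real.sin_add, Real.sin_sub]
  linear_combination Real.sin a ^ 2 * Real.sin_sq_add_cos_sq b -
    Real.sin b ^ 2 * Real.sin_sq_add_cos_sq a

/-- The integrating factor exp(-∫c) makes d monotone up to a positive factor; when d(0) = 0, the
source e(0) > 0 makes it positive immediately. -/
theorem pos_of_hasDerivAt_linear {d c e : ℝ → ℝ} (hc : Continuous c)
    (hd : ∀ x, HasDerivAt d (c x * d x + e x) x) (he : ∀ x, 0 ≤ e x) (h0 : 0 ≤ d 0)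
    (h1 : 0 < d 0 ∨ 0 < e 0) {x : ℝ} (hx : 0 < x) : 0 < d x := by
  have hE : ∀ x, HasDerivAt (fun x => Real.exp (-∫ t in (0 : ℝ)..x, c t))
      (Real.exp (-∫ t in (0 : ℝ)..x, c t) * -c x) x := fun x =>
    (intervalIntegral.integral_hasDerivAt_right (hc.intervalIntegrable _ _)
      (hc.stronglyMeasurableAtFilter _ _) hc.continuousAt).neg.exp
  set E : ℝ → ℝ := fun x => Real.exp (-∫ t in (0 : ℝ)..x, c t) with hEdef
  have hEpos : ∀ x, 0 < E x := fun x => Real.exp_pos _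
  have hE0 : E 0 = 1 := by simp [hEdef]
  have hD : ∀ x, HasDerivAt (fun x => d x * E x) (e x * E x) x := fun x =>
    ((hd x).mul (hE x)).congr_deriv (by simp only [hEdef]; ring)
  have hmono : Monotone fun x => d x * E x :=
    monotone_of_deriv_nonneg (fun x => (hD x).differentiableAt) fun x => by
      rw [(hD x).deriv]
      exact mul_nonneg (he x) (hEpos x).le
  suffices h : 0 < d x * E x from pos_of_mul_pos_left h (hEpos x).le
  rcases h0.lt_or_eq with h2 | h2
  · have := hmono hx.le
    simp only [hE0, mul_one] at this
    linarith
  · have he0 : 0 < e 0 := h1.resolve_left h2.not_lt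
    have hs := (hD 0).tendsto_slope.eventually (lt_mem_nhds (mul_pos he0 (hEpos 0)))
    have h3 : ∀ᶠ y in nhdsWithin (0 : ℝ) (Set.Ioi 0), 0 < slope (fun x => d x * E x) 0 y :=
      hs.filter_mono (nhdsWithin_mono _ fun y hy => ne_of_gt hy)
    obtain ⟨y, hy1, hy2⟩ := (h3.and (Ioo_mem_nhdsGT hx)).exists
    rw [slope_def_field, ← h2, zero_mul, sub_zero, sub_zero] at hy1
    have h4 : 0 < d y * E y := (div_pos_iff_of_pos_right hy2.1).mp hy1
    exact h4.trans_le (hmono hy2.2.le)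

namespace IsPruferAngle

variable {Q θ : ℝ → ℝ}

/-- Writing sin θ = θ sinc θ turns the angle equation into a linear one with continuous coefficient
and source 1. -/
theorem pos (hQ : Continuous Q) (h : IsPruferAngle Q θ) (h0 : 0 ≤ θ 0) {x : ℝ} (hx : 0 < x) :
    0 < θ x := by
  have hθ := h.continuous
  refine pos_of_hasDerivAt_linear (c := fun x => (Q x - 1) * (Real.sin (θ x) * Real.sinc (θ x)))
    (e := fun _ => 1) ?_ (fun x => (h x).congr_deriv ?_) (fun _ => zero_le_one) h0
    (Or.inr one_pos) hx
  · have := Real.continuous_sinc.comp hθ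
    exact (hQ.sub continuous_const).mul ((Real.continuous_sin.comp hθ).mul this)
  · linear_combination (-(Q x - 1) * Real.sin (θ x)) * Real.sinc_mul_self (θ x)

/-- By the sinc identity, θ₂ - θ₁ solves a linear equation with source (a₂ - a₁) sin² θ₂, positive
at the origin. -/
theorem lt_of_lt {θ₁ θ₂ q : ℝ → ℝ} {a₁ a₂ : ℝ} (hq : Continuous q)
    (h₁ : IsPruferAngle (fun x => a₁ + q x) θ₁) (h₂ : IsPruferAngle (fun x => a₂ + q x) θ₂)
    (h0 : θ₁ 0 = θ₂ 0) (hs : Real.sin (θ₂ 0) ≠ 0) (ha : a₁ < a₂) {x : ℝ} (hx : 0 < x) :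
    θ₁ x < θ₂ x := by
  have hθ₁ := h₁.continuous
  have hθ₂ := h₂.continuous
  suffices h : 0 < θ₂ x - θ₁ x by linarith
  refine pos_of_hasDerivAt_linear (d := fun x => θ₂ x - θ₁ x)
    (c := fun x => (a₁ + q x - 1) * (Real.sin (θ₁ x + θ₂ x) * Real.sinc (θ₂ x - θ₁ x)))
    (e := fun x => (a₂ - a₁) * Real.sin (θ₂ x) ^ 2) ?_
    (fun x => ((h₂ x).sub (h₁ x)).congr_deriv ?_)
    (fun x => mul_nonneg (sub_nonneg.mpr ha.le) (sq_nonneg _)) (by simp [h0])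
    (Or.inr (mul_pos (sub_pos.mpr ha) (by positivity))) hx
  · have := Real.continuous_sinc.comp (hθ₂.sub hθ₁)
    exact ((continuous_const.add hq).sub continuous_const).mul
      ((Real.continuous_sin.comp (hθ₁.add hθ₂)).mul this)
  · linear_combination (a₁ + q x - 1) * Real.sin_sq_sub_sin_sq_eq_sinc (θ₁ x) (θ₂ x)

theorem continuous_param {q : ℝ → ℝ} {θ : ℝ → ℝ → ℝ} (hb : ∃ M, ∀ x, |q x| ≤ M)
    (h : ∀ a, IsPruferAngle (fun x => a + q x) (θ a)) {θ₀ : ℝ} (h0 : ∀ a, θ a 0 = θ₀) {L : ℝ}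
    (hL : 0 ≤ L) : Continuous fun a => θ a L := by
  obtain ⟨M, hM⟩ := hb
  refine continuous_iff_continuousAt.mpr fun a => ?_
  have key : ∀ b, ‖θ b L - θ a L‖ ≤ gronwallBound 0 (|a| + M + 1) |b - a| L := fun b => by
    have hg := norm_le_gronwallBound_of_norm_deriv_right_le (a := 0) (b := L)
      (f := fun x => θ b x - θ a x) (δ := 0) (K := |a| + M + 1) (ε := |b - a|)
      ((h b).continuous.sub (h a).continuous).continuousOn
      (fun x _ => ((h b x).sub (h a x)).hasDerivWithinAt) (by simp [h0]) (fun x _ => by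
        have e : 1 + (b + q x - 1) * Real.sin (θ b x) ^ 2 -
            (1 + (a + q x - 1) * Real.sin (θ a x) ^ 2) =
            (a + q x - 1) * (Real.sin (θ b x) ^ 2 - Real.sin (θ a x) ^ 2) +
              (b - a) * Real.sin (θ b x) ^ 2 := by ring
        rw [e]
        refine (norm_add_le _ _).trans (add_le_add ?_ ?_)
        · rw [norm_mul]
          refine mul_le_mul ?_ (Real.abs_sin_sq_sub_sin_sq_le _ _) (norm_nonneg _) ?_
          · have h1 := abs_le.mp (hM x)
            rw [Real.norm_eq_abs, abs_le]
            constructor <;> linarith [neg_abs_le a, le_abs_self a]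
          · linarith [abs_nonneg a, (abs_nonneg _).trans (hM x)]
        · rw [norm_mul, Real.norm_eq_abs, Real.norm_eq_abs, abs_of_nonneg (sq_nonneg (Real.sin _))]
          exact mul_le_of_le_one_right (abs_nonneg _) (Real.sin_sq_le_one _)) L ⟨hL, le_rfl⟩
    simpa using hg
  rw [ContinuousAt, tendsto_iff_norm_sub_tendsto_zero]
  refine squeeze_zero (fun _ => norm_nonneg _) key ?_
  have hc : Continuous fun b => gronwallBound 0 (|a| + M + 1) |b - a| L :=
    (gronwallBound_continuous_ε 0 (|a| + M + 1) L).comp (by fun_prop)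
  simpa [gronwallBound_ε0_δ0] using hc.tendsto a

theorem exists_isFundamental (hQ : Continuous Q) (hb : ∃ M, ∀ x, |Q x| ≤ M)
    (h : IsPruferAngle Q θ) (h0 : θ 0 = Real.pi / 2) :
    ∃ (r s η : ℝ → ℝ), (∀ x, 0 < r x) ∧ (∀ x, 0 < s x) ∧ IsPruferAngle Q η ∧ η 0 = 0 ∧
      IsFundamental Q (fun x => r x * Real.sin (θ x)) (fun x => r x * Real.cos (θ x))
        (fun x => s x * Real.sin (η x)) (fun x => s x * Real.cos (η x)) := by
  obtain ⟨η, hη, hη0⟩ := exists_pruferAngle hQ hb 0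
  obtain ⟨r, hr, hr0, hrsol⟩ := h.exists_radius hQ
  obtain ⟨s, hs, hs0, hssol⟩ := hη.exists_radius hQ
  exact ⟨r, s, η, hr, hs, hη, hη0, hrsol, hssol, by simp [hr0, h0], by simp [h0], by simp [hη0],
    by simp [hs0, hη0]⟩

theorem add_nat_mul (hb : ∃ M, ∀ x, |Q x| ≤ M) (h : IsPruferAngle Q θ) {T : ℝ}
    (hQT : ∀ x, Q (x + T) = Q x) (hT : θ T = θ 0 + Real.pi) (n : ℕ) :
    θ (n * T) = θ 0 + n * Real.pi := by
  have hs : IsPruferAngle Q fun x => θ (x + T) - Real.pi := fun x => by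
    have := ((h (x + T)).comp_add_const x T).sub_const Real.pi
    rw [hQT] at this
    refine this.congr_deriv ?_
    rw [Real.sin_sub_pi, neg_sq]
  have he : ∀ x, θ (x + T) = θ x + Real.pi := fun x => by
    have := congrFun (h.eq_of_eq hb hs (a := 0) (by rw [zero_add, hT]; ring)) x
    linarith
  induction n with
  | zero => simp
  | succ n ih =>
    rw [Nat.cast_succ, add_mul, one_mul, he, ih]
    ring

/-- Reflection of a Prüfer angle at a centre of symmetry at which the solution vanishes. -/
theorem eq_reflect (hb : ∃ M, ∀ x, |Q x| ≤ M) (h : IsPruferAngle Q θ) {T : ℝ}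
    (hQT : ∀ x, Q (T - x) = Q x) (hT : θ (T / 2) = Real.pi) (x : ℝ) :
    θ x = 2 * Real.pi - θ (T - x) := by
  have hs : IsPruferAngle Q fun x => 2 * Real.pi - θ (T - x) := fun x => by
    have := ((h (T - x)).comp_const_sub T x).const_sub (2 * Real.pi)
    rw [hQT] at this
    refine this.congr_deriv ?_
    rw [Real.sin_two_pi_sub, neg_sq]
    ring
  exact congrFun (h.eq_of_eq hb hs (a := T / 2) (by
    rw [show T - T / 2 = T / 2 by ring, hT]; ring)) x

end IsPruferAngle

theorem eq_pi_of_sin_eq_zero {f : ℝ → ℝ} {a b : ℝ} (hab : a ≤ b)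
    (hf : ContinuousOn f (Set.Icc a b)) (ha : f a < Real.pi) (hb : 0 < f b)
    (hne : ∀ x ∈ Set.Ioo a b, Real.sin (f x) ≠ 0) (h0 : Real.sin (f b) = 0) : f b = Real.pi := by
  rcases lt_trichotomy (f b) Real.pi with h | h | h
  · exact absurd h0 (Real.sin_pos_of_pos_of_lt_pi hb h).ne'
  · exact h
  · obtain ⟨y, hy, hfy⟩ := intermediate_value_Ioo hab hf (⟨ha, h⟩ : Real.pi ∈ Set.Ioo (f a) (f b))
    exact absurd (by rw [hfy, Real.sin_pi]) (hne y hy)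

theorem mem_Ioo_of_sin_ne_zero {f : ℝ → ℝ} {a b : ℝ} (hab : a ≤ b)
    (hf : ContinuousOn f (Set.Icc a b)) (ha : f a ∈ Set.Ioo 0 Real.pi)
    (hne : ∀ x ∈ Set.Icc a b, Real.sin (f x) ≠ 0) : f b ∈ Set.Ioo 0 Real.pi := by
  constructor
  · exact pos_of_ne_zero_of_continuousOn hf ha.1
      (fun x hx h => hne x hx (by rw [h, Real.sin_zero])) b ⟨hab, le_rfl⟩
  · have := pos_of_ne_zero_of_continuousOn (f := fun x => Real.pi - f x)
      (continuousOn_const.sub hf) (sub_pos.mpr ha.2)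
      (fun x hx h => hne x hx (by rw [← sub_eq_zero.mp h, Real.sin_pi])) b ⟨hab, le_rfl⟩
    exact sub_pos.mp this

/-- For Q < 0, φ and φ' stay positive to the right of the origin, so the angle is trapped in the
first quadrant. -/
theorem IsPruferAngle.lt_pi_div_two {Q θ : ℝ → ℝ} (hQ : Continuous Q) (hb : ∃ M, ∀ x, |Q x| ≤ M)
    (h : IsPruferAngle Q θ) (h0 : θ 0 = Real.pi / 2) (hneg : ∀ x, Q x < 0) {L : ℝ} (hL : 0 < L) :
    θ L < Real.pi / 2 := by
  obtain ⟨r, s, η, hr, -, -, -, hF⟩ := h.exists_isFundamental hQ hb h0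
  have hpos : ∀ x, 0 < x → 0 < Real.sin (θ x) ∧ 0 < Real.cos (θ x) := fun x hx => by
    have := hF.pos_of_neg hx fun y _ => hneg y
    exact ⟨(mul_pos_iff_of_pos_left (hr x)).mp this.1,
      (mul_pos_iff_of_pos_left (hr x)).mp this.2.1⟩
  have hmem := mem_Ioo_of_sin_ne_zero hL.le h.continuous.continuousOn
    (by rw [h0]; constructor <;> linarith [Real.pi_pos]) fun x hx => by
      rcases eq_or_lt_of_le hx.1 with hx0 | hx0
      · rw [← hx0, h0]; simp
      · exact (hpos x hx0).1.ne'
  by_contra hc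
  exact absurd (hpos L hL).2 (not_lt.mpr (Real.cos_nonpos_of_pi_div_two_le_of_le (not_lt.mp hc)
    (by linarith [hmem.2, Real.pi_pos])))

/-- A strictly increasing continuous phase meets the zeros of the cosine once each. -/
theorem ncard_cos_eq_zero {Θ : ℝ → ℝ} {n : ℕ} (hmono : StrictMonoOn Θ (Set.Iic 0))
    (hcont : ContinuousOn Θ (Set.Iic 0)) (hlow : ∀ a ≤ 0, -(Real.pi / 2) < Θ a)
    (hstart : ∃ a ≤ 0, Θ a < Real.pi / 2)
    (hend : Θ 0 ∈ Set.Ioo (n * Real.pi - Real.pi / 2) (n * Real.pi + Real.pi / 2)) :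
    {a : ℝ | a < 0 ∧ Real.cos (Θ a) = 0}.ncard = n ∧ Real.cos (Θ 0) ≠ 0 := by
  have hpi := Real.pi_pos
  have himage : Θ '' {a : ℝ | a < 0 ∧ Real.cos (Θ a) = 0} =
      (fun j : ℕ => Real.pi / 2 + j * Real.pi) '' (Finset.range n : Set ℕ) := by
    ext y
    constructor
    · rintro ⟨a, ⟨ha, hcos⟩, rfl⟩
      obtain ⟨k, hk⟩ := Real.cos_eq_zero_iff.mp hcos
      have h1 := hlow a ha.le
      have h2 := hmono (Set.mem_Iic.mpr ha.le) (Set.mem_Iic.mpr le_rfl) ha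
      have h3 := hend.2
      have hk0 : (-1 : ℝ) < k := by
        rw [hk] at h1
        by_contra hc
        nlinarith [not_lt.mp hc]
      have hkn : (k : ℝ) < n := by
        rw [hk] at h2
        by_contra hc
        nlinarith [not_lt.mp hc]
      have hk0' : 0 ≤ k := by
        have : (-1 : ℤ) < k := by exact_mod_cast hk0
        omega
      obtain ⟨j, rfl⟩ := Int.eq_ofNat_of_zero_le hk0'
      refine ⟨j, ?_, ?_⟩
      · have : j < n := by exact_mod_cast hkn
        simpa using this
      · rw [hk]
        push_cast
        ring
    · rintro ⟨j, hj, rfl⟩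
      have hj' : (j : ℝ) + 1 ≤ n := by
        have : j < n := by simpa using hj
        exact_mod_cast this
      obtain ⟨a₀, ha₀, hlt⟩ := hstart
      have hmem : Real.pi / 2 + j * Real.pi ∈ Set.Ioo (Θ a₀) (Θ 0) := by
        constructor
        · have : 0 ≤ (j : ℝ) * Real.pi := by positivity
          linarith
        · have := hend.1
          nlinarith
      obtain ⟨a, ha, haΘ⟩ := intermediate_value_Ioo ha₀
        (hcont.mono Set.Icc_subset_Iic_self) hmem
      refine ⟨a, ⟨ha.2, ?_⟩, haΘ⟩
      rw [haΘ, Real.cos_eq_zero_iff]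
      exact ⟨j, by push_cast; ring⟩
  have hinj : Set.InjOn Θ {a : ℝ | a < 0 ∧ Real.cos (Θ a) = 0} :=
    hmono.injOn.mono fun a ha => Set.mem_Iic.mpr ha.1.le
  have hinj' : Function.Injective fun j : ℕ => Real.pi / 2 + j * Real.pi := fun i j hij => by
    have : (i : ℝ) * Real.pi = j * Real.pi := by simpa using hij
    exact_mod_cast mul_right_cancel₀ hpi.ne' this
  refine ⟨?_, fun hc => ?_⟩
  · rw [← hinj.ncard_image, himage, Set.ncard_image_of_injective _ hinj',
      Set.ncard_coe_finset, Finset.card_range]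
  · obtain ⟨k, hk⟩ := Real.cos_eq_zero_iff.mp hc
    rw [hk] at hend
    have h1 : (n : ℝ) - 1 < k := by
      by_contra hc
      nlinarith [not_lt.mp hc, hend.1]
    have h2 : (k : ℝ) < n := by
      by_contra hc
      nlinarith [not_lt.mp hc, hend.2]
    have h3 : (n : ℤ) - 1 < k := by exact_mod_cast h1
    have h4 : k < (n : ℤ) := by exact_mod_cast h2
    omega

/-! ### The angle at λ = 0 for L₊ and L₋ -/

namespace IsHalfWave

variable {p ω T : ℝ} {u u' : ℝ → ℝ}

theorem continuous_potential (hp : 0 < p) (h : IsHalfWave p ω T u u') (C : ℝ) :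
    Continuous fun x => C * |u x| ^ (2 * p) :=
  continuous_const.mul ((IsLinearSolution.continuous h.profile).abs.rpow_const
    fun _ => Or.inr (by linarith))

theorem potential_bounded (hp : 0 < p) (h : IsHalfWave p ω T u u') (C : ℝ) :
    ∃ M, ∀ x, |C * |u x| ^ (2 * p)| ≤ M := by
  have hper : Function.Periodic (fun x => C * |u x| ^ (2 * p)) T := fun x => by
    simp only [h.antiperiodic, abs_neg]
  obtain ⟨M, hM⟩ := isCompact_Icc.exists_bound_of_continuousOn (s := Set.Icc 0 T)
    (h.continuous_potential hp C).continuousOn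
  refine ⟨M, fun x => ?_⟩
  obtain ⟨y, hy, hxy⟩ := hper.exists_mem_Ico₀ h.pos_T x
  have := hM y (Set.Ico_subset_Icc_self hy)
  rwa [← hxy] at this

theorem add_potential_bounded (hp : 0 < p) (h : IsHalfWave p ω T u u') (C E : ℝ) :
    ∃ M, ∀ x, |E + C * |u x| ^ (2 * p)| ≤ M := by
  obtain ⟨M, hM⟩ := h.potential_bounded hp C
  exact ⟨|E| + M, fun x => (abs_add_le _ _).trans (by linarith [hM x])⟩

/-- The derivative of the wave solves the equation linearised at the wave. -/
theorem isLinearSolution_deriv (hp : 0 < p) (h : IsHalfWave p ω T u u') :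
    IsLinearSolution (fun x => ω + (2 * p + 1) * (p + 1) * |u x| ^ (2 * p)) u'
      (fun x => -((ω + (p + 1) * |u x| ^ (2 * p)) * u x)) :=
  ⟨h.profile.hasDerivAt', fun x =>
    ((IsProfile.hasDerivAt_force hp (u x)).comp x (h.profile.hasDerivAt x)).congr_deriv (by ring)⟩

theorem deriv_zero_pos (h : IsHalfWave p ω T u u') : 0 < u' 0 :=
  h.deriv_pos 0 ⟨le_rfl, by linarith [h.pos_T]⟩

/-- The even solution is a multiple of u', whose first zero is the crest T/2, so the angle is π
there. Reflection about T/2 sends π/2 to 3π/2: the angle gains exactly π per period. -/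
theorem angle_plus (hp : 0 < p) (h : IsHalfWave p ω T u u') {θ : ℝ → ℝ}
    (hθ : IsPruferAngle (fun x => ω + (2 * p + 1) * (p + 1) * |u x| ^ (2 * p)) θ)
    (h0 : θ 0 = Real.pi / 2) (n : ℕ) : θ (n * T) = n * Real.pi + Real.pi / 2 := by
  have hT := h.pos_T
  have hb := h.add_potential_bounded hp ((2 * p + 1) * (p + 1)) ω
  have hQc : Continuous fun x => ω + (2 * p + 1) * (p + 1) * |u x| ^ (2 * p) :=
    continuous_const.add (h.continuous_potential hp _)
  obtain ⟨r, s, η, hr, -, -, -, hF⟩ := hθ.exists_isFundamental hQc hb h0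
  have hu : ∀ x, u' x = u' 0 * r x * Real.sin (θ x) := fun x => by
    rw [(hF.eq_combination (h.isLinearSolution_deriv hp) x).1, h.zero]
    ring
  have hhalf : θ (T / 2) = Real.pi := by
    refine eq_pi_of_sin_eq_zero (by linarith : (0 : ℝ) ≤ T / 2) hθ.continuous.continuousOn
      (by rw [h0]; linarith [Real.pi_pos])
      (hθ.pos hQc (by rw [h0]; positivity) (by linarith)) (fun x hx hs => ?_) ?_
    · have := h.deriv_pos x ⟨hx.1.le, hx.2⟩
      rw [hu, hs, mul_zero] at this
      exact lt_irrefl _ this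
    · have := hu (T / 2)
      rw [h.deriv_half] at this
      rcases mul_eq_zero.mp this.symm with h1 | h1
      · exact absurd h1 (mul_pos h.deriv_zero_pos (hr _)).ne'
      · exact h1
  have hrefl := hθ.eq_reflect hb (T := T) (fun x => by
    rw [show T - x = -x + T by ring, h.potential_periodic, h.potential_even]) hhalf T
  rw [sub_self, h0] at hrefl
  rw [hθ.add_nat_mul hb (h.potential_periodic _ ω) (by rw [hrefl, h0]; ring) n, h0]
  ring

/-- The odd solution is a multiple of u, so its angle η equals nπ at nT. As rs sin(θ - η) = 1, the
difference stays in (0, π); the gap inequality at the zero ψ(nT) excludes its upper half. -/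
theorem angle_minus (hp : 0 < p) (hω : ω < 0) (h : IsHalfWave p ω T u u') {θ : ℝ → ℝ}
    (hθ : IsPruferAngle (fun x => ω + (p + 1) * |u x| ^ (2 * p)) θ)
    (h0 : θ 0 = Real.pi / 2) (n : ℕ) :
    θ (n * T) ∈ Set.Ioc (n * Real.pi) (n * Real.pi + Real.pi / 2) := by
  have hT := h.pos_T
  have hpi := Real.pi_pos
  have hb := h.add_potential_bounded hp (p + 1) ω
  have hQc : Continuous fun x => ω + (p + 1) * |u x| ^ (2 * p) :=
    continuous_const.add (h.continuous_potential hp _)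
  obtain ⟨r, s, η, hr, hs, hη, hη0, hF⟩ := hθ.exists_isFundamental hQc hb h0
  have hu : ∀ x, u x = u' 0 * s x * Real.sin (η x) := fun x => by
    rw [(hF.eq_combination h.profile x).1, h.zero]
    ring
  have hηT : η T = Real.pi := by
    refine eq_pi_of_sin_eq_zero hT.le hη.continuous.continuousOn (by rw [hη0]; exact hpi)
      (hη.pos hQc hη0.ge hT) (fun x hx hs => ?_) ?_
    · have := h.pos x hx
      rw [hu, hs, mul_zero] at this
      exact lt_irrefl _ this
    · have h1 := hu T
      have h2 := h.antiperiodic 0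
      rw [zero_add, h.zero, neg_zero] at h2
      rw [h2] at h1
      rcases mul_eq_zero.mp h1.symm with h1 | h1
      · exact absurd h1 (mul_pos h.deriv_zero_pos (hs _)).ne'
      · exact h1
  have hηn := hη.add_nat_mul hb (h.potential_periodic _ ω) (by rw [hηT, hη0, zero_add]) n
  rw [hη0, zero_add] at hηn
  have hdiff := mem_Ioo_of_sin_ne_zero (f := fun x => θ x - η x) (a := 0) (b := n * T)
    (by positivity) (hθ.continuous.sub hη.continuous).continuousOn
    (by rw [h0, hη0]; constructor <;> linarith) fun x _ hc => by
      have := hF.wronskian_eq_one x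
      rw [Real.sin_sub] at hc
      have e : r x * s x * (Real.sin (θ x) * Real.cos (η x) - Real.cos (θ x) * Real.sin (η x)) =
          1 := by linear_combination this
      rw [hc, mul_zero] at e
      exact zero_ne_one e
  simp only [hηn] at hdiff
  refine ⟨by linarith [hdiff.1], ?_⟩
  have hgap := h.mul_nonneg_of_right_eq_zero hp (by linarith) hω hF n (by
    simp only [hηn, Real.sin_nat_mul_pi, mul_zero])
  obtain ⟨α, hα⟩ : ∃ α, θ (n * T) = α + n * Real.pi := ⟨θ (n * T) - n * Real.pi, by ring⟩
  rw [hα, Real.sin_add_nat_mul_pi, Real.cos_add_nat_mul_pi] at hgap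
  rw [hα] at hdiff ⊢
  by_contra hc
  have hα1 : Real.pi / 2 < α := by linarith [not_le.mp hc]
  have hα2 : α < Real.pi := by linarith [hdiff.2]
  have hsin := Real.sin_pos_of_pos_of_lt_pi (by linarith) hα2
  have hcos := Real.cos_neg_of_pi_div_two_lt_of_lt hα1 (by linarith)
  have e : r (n * T) * ((-1) ^ n * Real.sin α) * (r (n * T) * ((-1) ^ n * Real.cos α)) =
      (r (n * T) * (-1) ^ n) ^ 2 * (Real.sin α * Real.cos α) := by ring
  rw [e] at hgap
  have hsq : 0 < (r (n * T) * (-1) ^ n) ^ 2 := by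
    have := hr (n * T)
    positivity
  nlinarith [mul_pos hsq (mul_pos hsin (neg_pos.mpr hcos))]

end IsHalfWave

/-! ### The boundary phase and the number of negative eigenvalues -/

/-- The boundary condition `2 f' + k f = 0` in terms of the Prüfer angle. -/
theorem boundary_iff_cos_eq_zero {r θ k : ℝ} (hr : 0 < r) :
    2 * (r * Real.cos θ) + k * (r * Real.sin θ) = 0 ↔
      Real.cos (θ - Real.arctan (k / 2)) = 0 := by
  have hc := Real.cos_arctan_pos (k / 2)
  have hs : Real.sin (Real.arctan (k / 2)) = k / 2 * Real.cos (Real.arctan (k / 2)) := by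
    rw [← Real.tan_mul_cos hc.ne', Real.tan_arctan]
  have e : 2 * r * Real.cos (θ - Real.arctan (k / 2)) =
      Real.cos (Real.arctan (k / 2)) *
        (2 * (r * Real.cos θ) + k * (r * Real.sin θ)) := by
    rw [Real.cos_sub, hs]
    ring
  constructor
  · intro h
    rw [h, mul_zero] at e
    exact (mul_eq_zero.mp e).resolve_left (by positivity)
  · intro h
    rw [h, mul_zero] at e
    exact (mul_eq_zero.mp e.symm).resolve_left hc.ne'

namespace IsHalfWave

variable {p ω T : ℝ} {u u' : ℝ → ℝ}

/-- The non-periodic eigenfunctions of the ring problem below the continuous spectrum. -/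
theorem exists_even_solution (hp : 0 < p) (h : IsHalfWave p ω T u u') {C : ℝ} (hC : 0 < C)
    {θ : ℝ → ℝ} {mu : ℝ} (hE : mu + ω < 0)
    (hθ : IsPruferAngle (fun x => mu + (ω + C * |u x| ^ (2 * p))) θ) (h0 : θ 0 = Real.pi / 2)
    {n : ℕ} (hn : 1 ≤ n) {L : ℝ} (hL : n * T = L) :
    ∃ φ : ℝ → ℝ, (∀ x, φ (-x) = φ x) ∧ ∀ U : ℝ → ℂ,
      (IsRingEigenfunction L ω (fun x => C * |u x| ^ (2 * p)) mu U ∧ ¬ MemH2Per L U) ↔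
        Real.cos (θ L - Real.arctan (Real.sqrt |ω + mu| / 2)) = 0 ∧
          ∃ z : ℂ, z ≠ 0 ∧ ∀ x ∈ Set.Icc (-L) L, U x = z * φ x := by
  have hQ : (fun x => mu + (ω + C * |u x| ^ (2 * p))) =
      fun x => (mu + ω) + C * |u x| ^ (2 * p) := by
    funext x
    ring
  rw [hQ] at hθ
  have hqc := h.continuous_potential hp C
  have hQc : Continuous fun x => (mu + ω) + C * |u x| ^ (2 * p) := continuous_const.add hqc
  obtain ⟨r, s, η, hr, -, -, -, hF⟩ := hθ.exists_isFundamental hQc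
    (h.add_potential_bounded hp C _) h0
  have heven := h.potential_even C (mu + ω)
  have hL0 : 0 < L := by
    have : (0 : ℝ) < n := by exact_mod_cast hn
    rw [← hL]
    exact mul_pos this h.pos_T
  refine ⟨fun x => r x * Real.sin (θ x), fun x => (hF.left_neg heven x).1, fun U => ?_⟩
  rw [nonperiodic_ringEigenfunction_iff hL0 hqc (fun x => by ring) heven hF hE (fun h1 => by
    rw [← hL] at h1 ⊢
    exact h.mul_nonneg_of_right_eq_zero hp hC hE hF n h1), boundary_iff_cos_eq_zero (hr L)]

theorem count (hp : 0 < p) {ε : ℝ} (hε : 0 < ε) (h : IsHalfWave p (-ε ^ 2) T u u') {C : ℝ}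
    (hC : C = p + 1 ∨ C = (2 * p + 1) * (p + 1)) {n : ℕ} (hn : 1 ≤ n) {L : ℝ} (hL : n * T = L) :
    {mu : ℝ | mu < 0 ∧ ∃ U : ℝ → ℂ,
        IsRingEigenfunction L (-ε ^ 2) (fun x => C * |u x| ^ (2 * p)) mu U ∧
          ¬ MemH2Per L U}.ncard = n ∧
      (∀ (mu : ℝ) (U W : ℝ → ℂ), mu < 0 →
        IsRingEigenfunction L (-ε ^ 2) (fun x => C * |u x| ^ (2 * p)) mu U → ¬ MemH2Per L U →
        IsRingEigenfunction L (-ε ^ 2) (fun x => C * |u x| ^ (2 * p)) mu W → ¬ MemH2Per L W →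
          ∃ c : ℂ, ∀ x ∈ Set.Icc (-L) L, W x = c * U x) ∧
      ¬ ∃ U : ℝ → ℂ, IsRingEigenfunction L (-ε ^ 2) (fun x => C * |u x| ^ (2 * p)) 0 U ∧
        ¬ MemH2Per L U := by
  have hpi := Real.pi_pos
  have hε2 : 0 < ε ^ 2 := by positivity
  have hC0 : 0 < C := by rcases hC with rfl | rfl <;> positivity
  have hL0 : 0 < L := by
    have : (0 : ℝ) < n := by exact_mod_cast hn
    rw [← hL]
    exact mul_pos this h.pos_T
  set q : ℝ → ℝ := fun x => -ε ^ 2 + C * |u x| ^ (2 * p) with hq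
  have hqc : Continuous q := continuous_const.add (h.continuous_potential hp C)
  have hqb : ∃ M, ∀ x, |q x| ≤ M := h.add_potential_bounded hp C _
  have hb : ∀ a : ℝ, ∃ M, ∀ x, |a + q x| ≤ M := fun a => by
    obtain ⟨M, hM⟩ := hqb
    exact ⟨|a| + M, fun x => (abs_add_le _ _).trans (by linarith [hM x])⟩
  have hex : ∀ a : ℝ, ∃ θ, IsPruferAngle (fun x => a + q x) θ ∧ θ 0 = Real.pi / 2 := fun a =>
    exists_pruferAngle (continuous_const.add hqc) (hb a) _
  choose θ hθ hθ0 using hex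
  set k : ℝ → ℝ := fun mu => Real.sqrt |-ε ^ 2 + mu| with hk
  have hkc : Continuous k := by fun_prop
  have hkanti : StrictAntiOn k (Set.Iic 0) := fun a ha b hb hab => by
    simp only [Set.mem_Iic] at ha hb
    refine Real.sqrt_lt_sqrt (abs_nonneg _) ?_
    rw [abs_of_neg (by linarith), abs_of_neg (by linarith)]
    linarith
  have hk0 : ∀ a ≤ 0, 0 < k a := fun a ha =>
    Real.sqrt_pos.mpr (abs_pos.mpr (by linarith))
  -- Subtracting arctan(k/2) absorbs the energy-dependent condition; both terms push Θ upwards as λ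
  -- increases.
  set Θ : ℝ → ℝ := fun a => θ a L - Real.arctan (k a / 2) with hΘ
  have hmono : StrictMonoOn Θ (Set.Iic 0) := fun a ha b hb hab => by
    have h1 := IsPruferAngle.lt_of_lt hqc (hθ a) (hθ b) (by rw [hθ0, hθ0]) (by simp [hθ0]) hab hL0
    have h2 : Real.arctan (k b / 2) < Real.arctan (k a / 2) :=
      Real.arctan_strictMono (by linarith [hkanti ha hb hab])
    simp only [hΘ]
    linarith
  have hcont : ContinuousOn Θ (Set.Iic 0) :=
    ((IsPruferAngle.continuous_param hqb hθ hθ0 hL0.le).sub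
      (Real.continuous_arctan.comp (hkc.div_const 2))).continuousOn
  have hlow : ∀ a ≤ 0, -(Real.pi / 2) < Θ a := fun a _ => by
    have h1 := (hθ a).pos (continuous_const.add hqc) (by rw [hθ0]; positivity) hL0
    have h2 := Real.arctan_lt_pi_div_two (k a / 2)
    simp only [hΘ]
    linarith
  have hstart : ∃ a ≤ 0, Θ a < Real.pi / 2 := by
    obtain ⟨M, hM⟩ := hqb
    have hM0 : 0 ≤ M := (abs_nonneg _).trans (hM 0)
    -- With |q| ≤ M this shift makes the potential at most -1, so the angle stays below π/2.
    refine ⟨-(M + 1), by linarith, ?_⟩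
    have h1 := (hθ (-(M + 1))).lt_pi_div_two (continuous_const.add hqc) (hb _) (hθ0 _)
      (fun x => show -(M + 1) + q x < 0 by linarith [(abs_le.mp (hM x)).2]) hL0
    have h2 : 0 < Real.arctan (k (-(M + 1)) / 2) :=
      Real.arctan_pos.mpr (half_pos (hk0 _ (by linarith)))
    simp only [hΘ]
    linarith
  have hangle : θ 0 L ∈ Set.Ioc (n * Real.pi) (n * Real.pi + Real.pi / 2) := by
    have h1 := hθ 0
    simp only [zero_add, hq] at h1
    rw [← hL]
    rcases hC with rfl | rfl
    · exact h.angle_minus hp (by linarith) h1 (hθ0 0) n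
    · rw [h.angle_plus hp h1 (hθ0 0) n]
      exact ⟨by linarith, le_rfl⟩
  have hend : Θ 0 ∈ Set.Ioo (n * Real.pi - Real.pi / 2) (n * Real.pi + Real.pi / 2) := by
    have h2 := Real.arctan_lt_pi_div_two (k 0 / 2)
    have h3 : 0 < Real.arctan (k 0 / 2) := Real.arctan_pos.mpr (half_pos (hk0 0 le_rfl))
    simp only [hΘ]
    constructor <;> linarith [hangle.1, hangle.2]
  have key := fun (mu : ℝ) (hmu : mu ≤ 0) =>
    h.exists_even_solution hp hC0 (mu := mu) (by linarith) (hθ mu) (hθ0 mu) hn hL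
  obtain ⟨hcard, hzero⟩ := ncard_cos_eq_zero hmono hcont hlow hstart hend
  refine ⟨?_, fun mu U W hmu hU hUp hW hWp => ?_, ?_⟩
  · rw [← hcard]
    congr 1
    ext mu
    refine and_congr_right fun hmu => ?_
    obtain ⟨φ, -, hφ⟩ := key mu hmu.le
    constructor
    · rintro ⟨U, hU⟩
      exact ((hφ U).mp hU).1
    · intro hcos
      exact ⟨fun x => φ x, (hφ _).mpr ⟨hcos, 1, one_ne_zero, fun x _ => (one_mul _).symm⟩⟩
  · obtain ⟨φ, -, hφ⟩ := key mu hmu.le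
    obtain ⟨-, z, hz, hzU⟩ := (hφ U).mp ⟨hU, hUp⟩
    obtain ⟨-, w, -, hwW⟩ := (hφ W).mp ⟨hW, hWp⟩
    refine ⟨w / z, fun x hx => ?_⟩
    rw [hzU x hx, hwW x hx]
    field_simp
  · rintro ⟨U, hU⟩
    obtain ⟨φ, -, hφ⟩ := key 0 le_rfl
    exact hzero ((hφ U).mp hU).1

end IsHalfWave

/-! ### Assembly -/

theorem IsRingState.exists_wave {p L ω : ℝ} {n : ℕ} {u : ℝ → ℝ} (hp : 0 < p) (hL : 0 < L)
    (hn : 1 ≤ n) (h : IsRingState p L n ω u) {q : ℝ → ℝ}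
    (hq : q ∈ ({potentialMinus p u, potentialPlus p u} : Set (ℝ → ℝ))) :
    ∃ v v' C, IsHalfWave p ω (L / n) v v' ∧ (C = p + 1 ∨ C = (2 * p + 1) * (p + 1)) ∧
      q = fun x => C * |v x| ^ (2 * p) := by
  obtain ⟨v, v', hv, habs⟩ := h.exists_isHalfWave hp hL hn
  rcases hq with rfl | hq
  · exact ⟨v, v', _, hv, Or.inl rfl, funext fun x => by rw [potentialMinus, habs]⟩
  · rw [Set.mem_singleton_iff] at hq
    exact ⟨v, v', _, hv, Or.inr rfl, hq.trans (funext fun x => by rw [potentialPlus, habs])⟩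

theorem mainTheorem10 (p L : ℝ) (hp : 0 < p) (hL : 0 < L) (n : ℕ) (hn : 1 ≤ n) :
    -- the eigenvalues with nonzero `V`, for every `ω < ω_n`
    (∀ ω : ℝ, ω < Real.pi ^ 2 * (n : ℝ) ^ 2 / L ^ 2 →
      ∀ u : ℝ → ℝ, IsRingState p L n ω u →
      ∀ q ∈ ({potentialMinus p u, potentialPlus p u} : Set (ℝ → ℝ)),
        (∀ (lam : ℂ) (U V : ℝ → ℂ),
          (IsTadpoleEigenfunction L ω q lam U V ∧ ∃ x ∈ Set.Ici L, V x ≠ 0) ↔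
            ∃ mu : ℝ, lam = (mu : ℂ) ∧ mu + ω < 0 ∧
              IsRingEigenfunction L ω q mu U ∧ ¬ MemH2Per L U ∧
              ∀ x ∈ Set.Ici L,
                V x = U L * (Real.exp (-(Real.sqrt |ω + mu| * (x - L))) : ℝ)) ∧
        (∀ (mu : ℝ) (U : ℝ → ℂ), mu + ω < 0 →
          IsRingEigenfunction L ω q mu U → ¬ MemH2Per L U →
            ∀ x ∈ Set.Icc (-L) L, U (-x) = U x)) ∧
    -- the count of negative and zero eigenvalues for `ω = -ε²`
    (∃ ε₀ : ℝ, 0 < ε₀ ∧ ∀ ε : ℝ, 0 < ε → ε < ε₀ →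
      ∀ u : ℝ → ℝ, IsRingState p L n (-ε ^ 2) u →
      ∀ q ∈ ({potentialMinus p u, potentialPlus p u} : Set (ℝ → ℝ)),
        {mu : ℝ | mu < 0 ∧
          ∃ U : ℝ → ℂ, IsRingEigenfunction L (-ε ^ 2) q mu U ∧ ¬ MemH2Per L U}.ncard = n ∧
        (∀ (mu : ℝ) (U W : ℝ → ℂ), mu < 0 →
          IsRingEigenfunction L (-ε ^ 2) q mu U → ¬ MemH2Per L U →
          IsRingEigenfunction L (-ε ^ 2) q mu W → ¬ MemH2Per L W →
            ∃ c : ℂ, ∀ x ∈ Set.Icc (-L) L, W x = c * U x) ∧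
        ¬ ∃ U : ℝ → ℂ, IsRingEigenfunction L (-ε ^ 2) q 0 U ∧ ¬ MemH2Per L U) := by
  have hn0 : (n : ℝ) ≠ 0 := by exact_mod_cast (show n ≠ 0 by omega)
  have hnL : n * (L / n) = L := mul_div_cancel₀ L hn0
  -- The value 1 for ε₀ is arbitrary: the count is valid for every ε > 0.
  refine ⟨fun ω _ u hu q hq => ?_, 1, one_pos, fun ε hε _ u hu q hq => ?_⟩
  · obtain ⟨v, v', C, hv, hC, rfl⟩ := hu.exists_wave hp hL hn hq
    have hC0 : 0 < C := by rcases hC with rfl | rfl <;> positivity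
    refine ⟨tadpoleEigenfunction_iff hL (hv.continuous_potential hp C),
      fun mu U hE hU hUp x hx => ?_⟩
    obtain ⟨θ, hθ, hθ0⟩ := exists_pruferAngle
      (Q := fun x => mu + (ω + C * |v x| ^ (2 * p)))
      (continuous_const.add (continuous_const.add (hv.continuous_potential hp C))) (by
        obtain ⟨M, hM⟩ := hv.add_potential_bounded hp C ω
        exact ⟨|mu| + M, fun x => (abs_add_le _ _).trans (by linarith [hM x])⟩) (Real.pi / 2)
    obtain ⟨φ, heven, hφ⟩ := hv.exists_even_solution hp hC0 hE hθ hθ0 hn hnL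
    obtain ⟨-, z, -, hz⟩ := (hφ U).mp ⟨hU, hUp⟩
    rw [hz x hx, hz (-x) ⟨by linarith [hx.2], by linarith [hx.1]⟩, heven]
  · obtain ⟨v, v', C, hv, hC, rfl⟩ := hu.exists_wave hp hL hn hq
    exact hv.count hp hε hC hn hnL
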